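/- **Decompositions.** All graphs are finite, simple and connected, with vertices named $0,\dots,|V|-1$. A tree decomposition of $G$ is a rooted ordered tree whose nodes carry bags (subsets of $V(G)$) such that every vertex and every edge of $G$ lies in some bag and, for every vertex, the nodes whose bags contain it form a connected subtree; its width $k$ is the maximum bag size minus one. A path decomposition is a tree decomposition whose tree is a path rooted at one end. A treedepth decomposition of $G$ is a rooted ordered tree with node set $V(G)$ in which the two ends of every edge of $G$ are in ancestor–descendant relation; its depth $k$ is the number of nodes on a longest root-to-leaf path. The separator of a node is its bag (tree and path decompositions) or the set of vertices on the path from the root to that node (treedepth decompositions). The size $n$ of a decomposition is its number of nodes. **Encoding.** Let $T$ be a tree, path or treedepth decomposition of width/depth $k$ of a graph $G$, and let $\xi\in\mathbb N$. Its encoding $\hat T$ over a fixed finite alphabet lists the nodes of $T$ in depth-first post-order. The record of a node consists of its separator (the list of the binary names of its vertices; bags in increasing order, root paths from the root downwards), the edges of $G$ contained in its separator but not in the separator of its parent (as pairs of positions in the list, in binary), and its number of children (in binary). The input word of the instance is $(k,\hat T,\xi)$, in this order. **Machine.** A dynamic programming Turing machine (DPTM) is a deterministic Turing machine with finitely many states,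 a read-only input tape whose head moves only forward, and a separate working tape over a finite alphabet. Its space is the number of working-tape cells it uses. It decides Dominating Set on tree (respectively path, treedepth) decompositions if on every input $(k,\hat T,\xi)$ as above with $T$ a tree (respectively path, treedepth) decomposition of a connected graph $G$ it halts, and it accepts if and only if $G$ has a dominating set of size at most $\xi$. It uses space $O((3-\varepsilon)^k\log n)$ if there are $c$ and $N$ such that on every such input with $k\ge N$ and $n\ge N$ it uses at most $c\,(3-\varepsilon)^k\log_2 n$ cells. **Theorem.** For every real $\varepsilon>0$ and for each of the three kinds of decomposition (tree decompositions, path decompositions, treedepth decompositions): no DPTM decides Dominating Set on decompositions of this kind using space $O((3-\varepsilon)^k\log n)$, where $k$ is the width (respectively depth) and $n$ the size of the given decomposition. -/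

import Mathlib

namespace DPSpace

/-! ### Rooted ordered trees -/

/-- Finite rooted ordered trees whose nodes carry labels in `α`. -/
inductive RTree (α : Type) : Type
  | node (label : α) (children : List (RTree α)) : RTree α

namespace RTree

variable {α β : Type}

/-- The label of the root. -/
def label : RTree α → α
  | node a _ => a

/-- The subtrees rooted at the children of the root, in order. -/
def children : RTree α → List (RTree α)
  | node _ cs => cs

/-- All complete subtrees, one for each node, in post-order. -/
def postorder : RTree α → List (RTree α)
  | node a cs => (cs.flatMap fun t => t.postorder) ++ [node a cs]

/-- The labels of all nodes, in post-order. -/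
def labels (t : RTree α) : List α := t.postorder.map label

/-- The number of nodes. -/
def size (t : RTree α) : ℕ := t.postorder.length

/-- The number of nodes on a longest path from the root to a leaf. -/
def height : RTree α → ℕ
  | node _ cs => 1 + (cs.map fun t => t.height).foldr max 0

/-- Relabel all nodes. -/
def map (f : α → β) : RTree α → RTree β
  | node a cs => node (f a) (cs.map fun t => t.map f)

/-- Auxiliary function for `rootPaths`: `P` is the list of labels strictly above the root. -/
def rootPathsAux (P : List α) : RTree α → RTree (List α)
  | node a cs => node (P ++ [a]) (cs.map fun t => t.rootPathsAux (P ++ [a]))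

/-- Replace the label of each node by the list of labels on the path from the root to that node
(both ends included). -/
def rootPaths (t : RTree α) : RTree (List α) := t.rootPathsAux []

/-- The subtree at an address; an address lists the indices of the children that are entered on the
way down from the root. -/
def subtreeAt : RTree α → List ℕ → Option (RTree α)
  | t, [] => some t
  | t, i :: p => t.children[i]?.bind fun c => c.subtreeAt p

/-- Some node labelled `u` is an ancestor of (or equal to) some node labelled `v`. -/
def IsAncestor (t : RTree α) (u v : α) : Prop :=
  ∃ s ∈ t.postorder, s.label = u ∧ v ∈ s.labels

/-- The tree is a path, rooted at one of its ends. -/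
def IsPath (t : RTree α) : Prop := ∀ s ∈ t.postorder, s.children.length ≤ 1

end RTree

/-- The graph on addresses in which each address is adjacent to its one-step extensions. On the
addresses of the nodes of a tree it is the underlying undirected tree. -/
def addressGraph : SimpleGraph (List ℕ) :=
  SimpleGraph.fromRel fun p q => ∃ i, q = p ++ [i]

/-! ### Decompositions -/

section Decompositions

variable {n : ℕ} (G : SimpleGraph (Fin n))

/-- `T`, a rooted ordered tree of bags, is a tree decomposition of `G`: bags cover all vertices and
all edges, and for each vertex the nodes whose bags contain it are connected in the tree. -/
structure IsTreeDecomposition (T : RTree (Finset (Fin n))) : Prop where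
  vertex_mem : ∀ v, ∃ B ∈ T.labels, v ∈ B
  edge_mem : ∀ u v, G.Adj u v → ∃ B ∈ T.labels, u ∈ B ∧ v ∈ B
  connected : ∀ v, (addressGraph.induce
    {p | ∃ s, T.subtreeAt p = some s ∧ v ∈ s.label}).Preconnected

/-- The width of a tree of bags: the largest size of a bag, minus one. -/
def bagWidth (T : RTree (Finset (Fin n))) : ℕ := (T.labels.map Finset.card).foldr max 0 - 1

/-- `T` is a treedepth decomposition of `G`: each vertex of `G` labels exactly one node, and the
ends of each edge are in ancestor-descendant relation. -/
structure IsTreedepthDecomposition (T : RTree (Fin n)) : Prop where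
  vertex_mem : ∀ v, v ∈ T.labels
  nodup : T.labels.Nodup
  edge_ancestor : ∀ u v, G.Adj u v → T.IsAncestor u v ∨ T.IsAncestor v u

/-- `S` is a dominating set of `G`. -/
def IsDominatingSet (S : Finset (Fin n)) : Prop := ∀ v, v ∈ S ∨ ∃ u ∈ S, G.Adj u v

end Decompositions

/-! ### Instances and their encoding -/

/-- Data of an instance of a graph problem with an integer parameter, presented through a
decomposition. -/
structure DPInstance where
  /-- number of vertices of the graph -/
  order : ℕ
  /-- the graph; its vertices are named `0, …, order - 1` -/
  graph : SimpleGraph (Fin order)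
  /-- the decomposition, given as the rooted ordered tree of its separators (bags, or root paths
  for a treedepth decomposition), each presented as a list of vertices -/
  seps : RTree (List (Fin order))
  /-- width or depth of the decomposition -/
  width : ℕ
  /-- the non-graph part of the input -/
  budget : ℕ

namespace DPInstance

/-- The size of the decomposition: its number of nodes. -/
def size (I : DPInstance) : ℕ := I.seps.size

/-- Instances of Dominating Set with the answer yes. -/
def HasDominatingSet (I : DPInstance) : Prop :=
  ∃ S : Finset (Fin I.order), IsDominatingSet I.graph S ∧ S.card ≤ I.budget

end DPInstance

/-- Well-formed instances with a tree decomposition of width `width` of a connected graph. Bags are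
listed in increasing order of the vertex names. -/
def treeInstances : Set DPInstance :=
  {I | I.graph.Connected ∧ ∃ T : RTree (Finset (Fin I.order)),
    IsTreeDecomposition I.graph T ∧ I.width = bagWidth T ∧ I.seps = T.map fun B => B.sort}

/-- Well-formed instances with a path decomposition of width `width` of a connected graph. -/
def pathInstances : Set DPInstance :=
  {I | I.graph.Connected ∧ ∃ T : RTree (Finset (Fin I.order)), T.IsPath ∧
    IsTreeDecomposition I.graph T ∧ I.width = bagWidth T ∧ I.seps = T.map fun B => B.sort}

/-- Well-formed instances with a treedepth decomposition of depth `width` of a connected graph. The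
separator of a node is the path from the root to the node. -/
def treedepthInstances : Set DPInstance :=
  {I | I.graph.Connected ∧ ∃ T : RTree (Fin I.order),
    IsTreedepthDecomposition I.graph T ∧ I.width = T.height ∧ I.seps = T.rootPaths}

/-- The input alphabet. -/
inductive Sym : Type
  | bit (b : Bool)
  | comma
  | bar
  | endmark

/-- A number in binary, terminated by a comma. -/
def encodeNat (m : ℕ) : List Sym := m.bits.map Sym.bit ++ [Sym.comma]

section Encoding

variable {n : ℕ} (G : SimpleGraph (Fin n))

open Classical in
/-- The edges of `G` inside the separator `B` that are not inside the parent's separator `P`; an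
edge is given by the positions of its ends in `B`. Over the whole decomposition each edge is listed
once; in a treedepth decomposition a node lists the edges to its ancestors. -/
noncomputable def newEdges (P B : List (Fin n)) : List (Fin B.length × Fin B.length) :=
  (List.finRange B.length ×ˢ List.finRange B.length).filter fun e =>
    e.1 < e.2 ∧ G.Adj (B.get e.1) (B.get e.2) ∧ ¬ (B.get e.1 ∈ P ∧ B.get e.2 ∈ P)

/-- The code of one node: its separator, its edges, and its number `d` of children. -/
noncomputable def encodeNode (P B : List (Fin n)) (d : ℕ) : List Sym :=
  (B.flatMap fun v => encodeNat v) ++ [Sym.bar] ++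
    ((newEdges G P B).flatMap fun e => encodeNat e.1 ++ encodeNat e.2) ++ [Sym.bar] ++
    encodeNat d

/-- The codes of all nodes in post-order; `P` is the separator of the parent of the root (empty if
there is none). -/
noncomputable def encodeTree (P : List (Fin n)) : RTree (List (Fin n)) → List Sym
  | .node B cs => (cs.flatMap fun t => encodeTree B t) ++ encodeNode G P B cs.length

end Encoding

/-- The input word of an instance: the width, the decomposition, the budget. -/
noncomputable def DPInstance.encode (I : DPInstance) : List Sym :=
  encodeNat I.width ++ encodeTree I.graph [] I.seps ++ [Sym.endmark] ++ encodeNat I.budget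

/-! ### Machines -/

/-- Moves of the head of the working tape. -/
inductive Move : Type
  | left
  | right
  | stay

/-- What a machine does in one step. -/
structure Action (State Work : Type) : Type where
  /-- next state -/
  state : State
  /-- symbol written on the working tape -/
  write : Work
  /-- movement of the head of the working tape -/
  move : Move
  /-- whether the input head advances to the next input symbol -/
  advance : Bool

/-- A deterministic Turing machine with a read-only input tape, whose head moves only forward, and a
separate working tape. The transition function sees the state, the scanned input symbol (`none`
beyond the end of the input) and the scanned working symbol; the machine halts if it is `none`. -/
structure DPTM : Type 1 where
  State : Type
  state_finite : Finite State
  Work : Type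
  work_finite : Finite Work
  blank : Work
  start : State
  accepting : State → Bool
  trans : State → Option Sym → Work → Option (Action State Work)

namespace DPTM

variable (M : DPTM)

/-- A configuration. The working tape has cells `0, 1, 2, …`. -/
structure Cfg : Type where
  state : M.State
  /-- the part of the input that starts at the input head -/
  input : List Sym
  tape : ℕ → M.Work
  head : ℕ

/-- The initial configuration on the input `w`. -/
def init (w : List Sym) : M.Cfg := ⟨M.start, w, fun _ => M.blank, 0⟩

/-- The new head position; a left move in cell `0` has no effect. -/
def moveHead : Move → ℕ → ℕ
  | .left, h => h - 1
  | .right, h => h + 1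
  | .stay, h => h

/-- One step; `none` if the machine has halted. -/
def step (c : M.Cfg) : Option M.Cfg :=
  (M.trans c.state c.input.head? (c.tape c.head)).map fun a =>
    { state := a.state
      input := if a.advance then c.input.tail else c.input
      tape := Function.update c.tape c.head a.write
      head := moveHead a.move c.head }

/-- On input `w` the machine halts with the verdict `b`. -/
def HaltsWith (w : List Sym) (b : Bool) : Prop :=
  ∃ c, StateTransition.Reaches M.step (M.init w) c ∧ M.step c = none ∧ M.accepting c.state = b

/-- On input `w` the machine visits at most `S` cells of the working tape. -/
def SpaceAtMost (w : List Sym) (S : ℝ) : Prop :=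
  ∀ c, StateTransition.Reaches M.step (M.init w) c → (c.head : ℝ) + 1 ≤ S

/-- On the instances in `C` the machine decides Dominating Set. -/
def DecidesDominatingSet (C : Set DPInstance) : Prop :=
  ∀ I ∈ C, (I.HasDominatingSet → M.HaltsWith I.encode true) ∧
    (¬ I.HasDominatingSet → M.HaltsWith I.encode false)

/-- On the instances in `C` the machine uses space `O(b ^ k * log n)`, where `k` is the width or
depth and `n` the size of the decomposition: the bound has to hold once `k` and `n` are both large
enough. -/
def UsesSpaceBigO (C : Set DPInstance) (b : ℝ) : Prop :=
  ∃ (c : ℝ) (N : ℕ), ∀ I ∈ C, N ≤ I.width → N ≤ I.size →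
    M.SpaceAtMost I.encode (c * (b ^ I.width * Real.logb 2 I.size))

end DPTM

end DPSpace

/-! The input head never moves back, so once a prefix has been read all that the machine retains is
its state, its head position and the working tape. If the subsets of a set `A` are written in the
prefix and every element of `A` can be tested for membership by a suffix, then `2 ^ |A|` memory
contents are needed, hence space linear in `|A|` (`DPTM.two_pow_card_le`,
`DPTM.card_le_linear_space`). It remains to find such instances of width `s + O(1)` with `|A|` close
to `3 ^ s`.

The prefix encodes a set `F` of vectors in `{0, 1, 2} ^ s`, the suffix a vector `y`, and the answer
is whether some `x ∈ F` lies below `y`. On an antichain this is the question `y ∈ F`, and some level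
of the coordinate sum is an antichain with at least `3 ^ s / (2 * s + 1)` elements
(`exists_antichain`). The decompositions have `2 ^ O(s)` nodes, so `log n = O(s)` and space `O(b ^ k
* log n)` with `b < 3` is too small (`not_decides_of_hardFamily`).

In the graph, `y i` fixes the status of the boundary vertex `b i`: for `2` the budget pays for
choosing it, for `1` it is dominated by `hub`, and for `0` it has to be dominated by a gadget. Each
vector `x` has a gadget that costs at least one vertex, and exactly one only if that vertex is `n
x`. The budget leaves one extra vertex, and `beta₁`, `beta₂` force it to be spent on replacing `n
x₀` by `a₁ x₀` and `a₂ x₀` for a single `x₀`. Then `g₁ x₀` forces `x₀ ∈ F`, each `b i` with `y i =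
0` forces `x₀ i = 0`, and each `w x₀ i` with `x₀ i = 2` forces `b i` to be chosen, hence `y i = 2`.
So `x₀` lies below `y`; the converse is `Vertex.exists_dominates`.

The `s + 3` core vertices separate the gadgets from each other and from everything that depends on
`y`. With the gadgets at the lower end of the path, or in the first subtrees below `hub`, post-order
lists them first, and edges inside the core are recorded only at nodes listed later. Hence the
prefix does not depend on `y`, nor the rest on `F` (`encodeTree_congr`). -/

namespace DPSpace

/-! ### Memory of a machine with one-way input. -/

namespace DPTM

variable {M : DPTM}

/-- Append `v` to the unread input. -/
def Cfg.appendInput (v : List Sym) (c : M.Cfg) : M.Cfg := { c with input := c.input ++ v }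

/-- A step of the machine that is carried out only while some input is left. -/
def prefixStep (M : DPTM) (c : M.Cfg) : Option M.Cfg :=
  if c.input.isEmpty then none else M.step c

theorem step_appendInput (v : List Sym) {c : M.Cfg} (h : c.input ≠ []) :
    M.step (c.appendInput v) = (M.step c).map (Cfg.appendInput v) := by
  obtain ⟨q, w, t, p⟩ := c
  cases w with
  | nil => exact absurd rfl h
  | cons a w =>
    simp only [step, Cfg.appendInput, List.cons_append, List.head?_cons, Option.map_map,
      List.tail_cons]
    congr 1
    funext x
    cases hx : x.advance <;> simp [hx, Cfg.appendInput]

/-- Cut the halting run at the first moment when the prefix is used up or the machine stops; until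
then the suffix `v` does not influence the transitions. -/
theorem exists_prefixStep_halt (v : List Sym) {d e : M.Cfg}
    (h : StateTransition.Reaches M.step d e) (he : M.step e = none) :
    ∀ c : M.Cfg, d = c.appendInput v →
      ∃ c', StateTransition.Reaches M.prefixStep c c' ∧ M.prefixStep c' = none ∧
        StateTransition.Reaches M.step (c'.appendInput v) e := by
  induction h using Relation.ReflTransGen.head_induction_on with
  | refl =>
    rintro c rfl
    refine ⟨c, .refl, ?_, .refl⟩
    by_cases hc : c.input = []
    · simp [prefixStep, hc]
    · rw [step_appendInput v hc] at he
      simpa [prefixStep] using fun _ => by simpa using he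
  | head h1 h2 ih =>
    rintro c rfl
    by_cases hc : c.input = []
    · exact ⟨c, .refl, by simp [prefixStep, hc], .head h1 h2⟩
    · rw [step_appendInput v hc] at h1
      simp only [Option.mem_def, Option.map_eq_some_iff] at h1
      obtain ⟨c1, hc1, rfl⟩ := h1
      obtain ⟨c', hr, hn, hr'⟩ := ih c1 rfl
      exact ⟨c', .head (by simpa [prefixStep, hc] using hc1) hr, hn, hr'⟩

theorem reaches_appendInput (v : List Sym) {c c' : M.Cfg}
    (h : StateTransition.Reaches M.prefixStep c c') :
    StateTransition.Reaches M.step (c.appendInput v) (c'.appendInput v) := by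
  induction h with
  | refl => exact .refl
  | @tail c1 c2 _ h2 ih =>
    refine .tail ih ?_
    by_cases hc : c1.input = []
    · simp [prefixStep, hc] at h2
    · rw [step_appendInput v hc]
      simp only [prefixStep, List.isEmpty_iff, hc, if_false, Option.mem_def] at h2
      simp [h2]

theorem reaches_halt_unique {σ : Type*} {f : σ → Option σ} {a b c : σ}
    (hb : StateTransition.Reaches f a b) (hb' : f b = none)
    (hc : StateTransition.Reaches f a c) (hc' : f c = none) : b = c := by
  rcases StateTransition.reaches_total hb hc with h | h
  · rcases Relation.ReflTransGen.cases_head h with h | ⟨d, h, -⟩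
    · exact h
    · simp [hb'] at h
  · rcases Relation.ReflTransGen.cases_head h with h | ⟨d, h, -⟩
    · exact h.symm
    · simp [hc'] at h

/-- A cell changes only under the head, which stays below `S`. So the first `S` cells determine the
tape. -/
theorem tape_eq_blank {w : List Sym} {S : ℕ} (hS : M.SpaceAtMost w S) {c : M.Cfg}
    (h : StateTransition.Reaches M.step (M.init w) c) {j : ℕ} (hj : S ≤ j) :
    c.tape j = M.blank := by
  induction h with
  | refl => rfl
  | @tail c1 c2 h1 h2 ih =>
    have hh : c1.head + 1 ≤ S := by exact_mod_cast hS c1 h1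
    simp only [step, Option.mem_def, Option.map_eq_some_iff] at h2
    obtain ⟨a, -, rfl⟩ := h2
    have : j ≠ c1.head := by omega
    simp [Function.update_of_ne this, ih]

/-- If a machine separates all subsets `F` of `A` by means of suffixes `suf y`, `y ∈ A`, of its
input, then it has at least `2 ^ |A|` memory contents after reading the prefix. -/
theorem two_pow_card_le (M : DPTM) {α : Type*} [DecidableEq α] (A : Finset α) (hA : A.Nonempty)
    (pre : Finset α → List Sym) (suf : α → List Sym) (S : ℕ)
    (hdec : ∀ F ⊆ A, ∀ y ∈ A, M.HaltsWith (pre F ++ suf y) (decide (y ∈ F)))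
    (hS : ∀ F ⊆ A, ∀ y ∈ A, M.SpaceAtMost (pre F ++ suf y) S) :
    2 ^ A.card ≤ Nat.card (Bool × M.State × Fin S × (Fin S → M.Work)) := by
  classical
  have := M.state_finite
  have := M.work_finite
  -- Halting and the space bound are known only for complete inputs, so the run on the prefix is
  -- controlled through one fixed suffix.
  obtain ⟨y₀, hy₀⟩ := hA
  have key : ∀ F : A.powerset, ∃ c : M.Cfg,
      StateTransition.Reaches M.prefixStep (M.init (pre F)) c ∧ M.prefixStep c = none := by
    rintro ⟨F, hF⟩
    obtain ⟨e, he, hn, -⟩ := hdec F (Finset.mem_powerset.1 hF) y₀ hy₀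
    obtain ⟨c, h1, h2, -⟩ := exists_prefixStep_halt (suf y₀) he hn (M.init (pre F)) rfl
    exact ⟨c, h1, h2⟩
  choose c hc hc' using key
  have reach : ∀ (F : A.powerset) (v : List Sym),
      StateTransition.Reaches M.step (M.init (pre F ++ v)) ((c F).appendInput v) :=
    fun F v => reaches_appendInput v (hc F)
  have head_lt : ∀ F : A.powerset, (c F).head < S := fun F => by
    exact_mod_cast hS F (Finset.mem_powerset.1 F.2) y₀ hy₀ _ (reach F (suf y₀))
  have blank : ∀ (F : A.powerset) (j : ℕ), S ≤ j → (c F).tape j = M.blank := fun F j hj =>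
    tape_eq_blank (hS F (Finset.mem_powerset.1 F.2) y₀ hy₀) (reach F (suf y₀)) hj
  have halt : ∀ (F : A.powerset), ∀ y ∈ A, ∃ e,
      StateTransition.Reaches M.step ((c F).appendInput (suf y)) e ∧ M.step e = none ∧
        M.accepting e.state = decide (y ∈ F.1) := by
    intro F y hy
    obtain ⟨e, he, hn, ha⟩ := hdec F (Finset.mem_powerset.1 F.2) y hy
    obtain ⟨d, h1, h2, h3⟩ := exists_prefixStep_halt (suf y) he hn (M.init (pre F)) rfl
    obtain rfl := reaches_halt_unique (hc F) (hc' F) h1 h2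
    exact ⟨e, h3, hn, ha⟩
  -- Of the unread prefix only its emptiness is recorded. If it is empty, these data determine the
  -- configuration; if not, the machine has halted inside the prefix and its state alone gives the
  -- verdict for every suffix.
  let φ : A.powerset → Bool × M.State × Fin S × (Fin S → M.Work) := fun F =>
    ((c F).input.isEmpty, (c F).state, ⟨(c F).head, head_lt F⟩, fun j => (c F).tape j)
  have hφ : Function.Injective φ := by
    intro F F' h
    simp only [φ, Prod.mk.injEq, Fin.mk.injEq] at h
    obtain ⟨h1, h2, h3, h4⟩ := h
    have ht : (c F).tape = (c F').tape := by
      funext j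
      by_cases hj : j < S
      · exact congrFun h4 ⟨j, hj⟩
      · rw [blank F j (by omega), blank F' j (by omega)]
    have verdict : ∀ y ∈ A, (decide (y ∈ F.1) = decide (y ∈ F'.1)) := by
      intro y hy
      obtain ⟨e, he, hn, ha⟩ := halt F y hy
      obtain ⟨e', he', hn', ha'⟩ := halt F' y hy
      by_cases hi : (c F).input = []
      · have hi' : (c F').input = [] := by simpa [hi] using h1
        have hcc : c F = c F' := by
          generalize c F = a at *
          generalize c F' = b at *
          cases a; cases b; simp_all
        rw [hcc] at he
        rw [← ha, ← ha', reaches_halt_unique he hn he' hn']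
      · have hi' : (c F').input ≠ [] := by
          intro h; rw [h] at h1; simp [hi] at h1
        have halted : ∀ G : A.powerset, (c G).input ≠ [] → ∀ v,
            M.step ((c G).appendInput v) = none := by
          intro G hG v
          have := hc' G
          simp only [prefixStep, List.isEmpty_iff, hG, if_false] at this
          rw [step_appendInput v hG, this]; rfl
        rw [← ha, ← ha', ← reaches_halt_unique .refl (halted F hi _) he hn,
          ← reaches_halt_unique .refl (halted F' hi' _) he' hn']
        simp [Cfg.appendInput, h2]
    apply Subtype.ext
    ext y
    by_cases hy : y ∈ A
    · simpa using verdict y hy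
    · exact ⟨fun h => absurd (Finset.mem_powerset.1 F.2 h) hy,
        fun h => absurd (Finset.mem_powerset.1 F'.2 h) hy⟩
  have := Nat.card_le_card_of_injective φ hφ
  rwa [Nat.card_eq_fintype_card, Fintype.card_coe, Finset.card_powerset] at this

/-- The size of a separable family is at most linear in the space. -/
theorem card_le_linear_space (M : DPTM) : ∃ a : ℕ, ∀ {α : Type} [DecidableEq α] (A : Finset α),
    A.Nonempty → ∀ (pre : Finset α → List Sym) (suf : α → List Sym) (S : ℕ),
    (∀ F ⊆ A, ∀ y ∈ A, M.HaltsWith (pre F ++ suf y) (decide (y ∈ F))) →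
    (∀ F ⊆ A, ∀ y ∈ A, M.SpaceAtMost (pre F ++ suf y) S) → A.card ≤ a * (S + 1) := by
  have := M.state_finite
  have := M.work_finite
  have := Fintype.ofFinite M.State
  have := Fintype.ofFinite M.Work
  refine ⟨Nat.card M.State + Nat.card M.Work + 1, fun {α} _ A hA pre suf S h1 h2 => ?_⟩
  have h := two_pow_card_le M A hA pre suf S h1 h2
  simp only [Nat.card_prod, Nat.card_fun] at h
  simp only [Nat.card_eq_fintype_card, Fintype.card_bool, Fintype.card_fin] at h ⊢
  set q := Fintype.card M.State
  set γ := Fintype.card M.Work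
  -- Apply `m ≤ 2 ^ m` to `q`, `S` and `γ`; the exponent is then linear in `S`.
  have h3 : 2 * (q * (S * γ ^ S)) ≤ 2 ^ (1 + (q + (S + γ * S))) := by
    simp only [pow_add, pow_one, pow_mul]
    gcongr
    · exact Nat.lt_two_pow_self.le
    · exact Nat.lt_two_pow_self.le
    · exact Nat.lt_two_pow_self.le
  have := (Nat.pow_le_pow_iff_right (by norm_num)).1 (h.trans h3)
  nlinarith
end DPTM

/-! ### Large antichains, and the space bound from hard families. -/

theorem exists_antichain (s : ℕ) : ∃ A : Finset (Fin s → Fin 3),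
    3 ^ s ≤ (2 * s + 1) * A.card ∧ ∀ x ∈ A, ∀ y ∈ A, (∀ i, x i ≤ y i) → x = y := by
  classical
  -- The coordinate sum takes at most `2 * s + 1` values, so a largest fibre has the required size;
  -- comparable vectors with equal sums coincide.
  let f : (Fin s → Fin 3) → ℕ := fun x => ∑ i, (x i : ℕ)
  let fib : ℕ → Finset (Fin s → Fin 3) := fun r => Finset.univ.filter fun x => f x = r
  obtain ⟨r, -, hr⟩ := Finset.exists_max_image (Finset.range (2 * s + 1)) (fun r => (fib r).card)
    ⟨0, by simp⟩
  refine ⟨fib r, ?_, fun x hx y hy h => ?_⟩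
  · have hmaps : ∀ x ∈ (Finset.univ : Finset (Fin s → Fin 3)), f x ∈ Finset.range (2 * s + 1) := by
      intro x _
      have : f x ≤ ∑ _i : Fin s, 2 := Finset.sum_le_sum fun i _ => by omega
      simp at this
      simp; omega
    have := Finset.card_le_mul_card_image_of_maps_to hmaps (fib r).card hr
    simpa [mul_comm] using this
  · have hx' : f x = r := by simpa [fib] using hx
    have hy' : f y = r := by simpa [fib] using hy
    have := (Finset.sum_eq_sum_iff_of_le (s := Finset.univ) (f := fun i => (x i : ℕ))
      (g := fun i => (y i : ℕ)) (fun i _ => h i)).1 (hx'.trans hy'.symm)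
    funext i
    exact Fin.ext (this i (Finset.mem_univ i))

theorem eventually_lt_three_pow (C : ℝ) {b : ℝ} (hb : 0 ≤ b) (hb3 : b < 3) :
    ∀ᶠ s : ℕ in Filter.atTop, C * ((s : ℝ) + 1) ^ 2 * b ^ s < 3 ^ s := by
  have h0 := tendsto_pow_const_mul_const_pow_of_abs_lt_one 2 (r := b / 3)
    (by rw [abs_of_nonneg (by positivity)]; linarith)
  have h1 : Filter.Tendsto (fun s : ℕ => (4 * |C|) * ((s : ℝ) ^ 2 * (b / 3) ^ s)) Filter.atTop
      (nhds ((4 * |C|) * 0)) := h0.const_mul _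
  rw [mul_zero] at h1
  filter_upwards [h1.eventually_lt_const one_pos, Filter.eventually_ge_atTop 1] with s hs hs1
  rw [div_pow, mul_div_assoc', mul_div_assoc', div_lt_one (by positivity)] at hs
  refine lt_of_le_of_lt ?_ hs
  have hs1' : (1 : ℝ) ≤ s := by exact_mod_cast hs1
  have : ((s : ℝ) + 1) ^ 2 ≤ 4 * (s : ℝ) ^ 2 := by nlinarith
  calc C * ((s : ℝ) + 1) ^ 2 * b ^ s ≤ |C| * (4 * (s : ℝ) ^ 2) * b ^ s := by
        gcongr; exact le_abs_self C
    _ = _ := by ring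

/-- Input words of a family of instances of width `s + d`, one for each set `F` and each vector `y`
in `{0, 1, 2} ^ s`: a prefix depends on `F` only, the rest on `y` only, and the answer is yes if and
only if `F` contains a vector below `y`. -/
structure HardFamily (C : Set DPInstance) (d s : ℕ) where
  inst : Finset (Fin s → Fin 3) → (Fin s → Fin 3) → DPInstance
  pre : Finset (Fin s → Fin 3) → List Sym
  suf : (Fin s → Fin 3) → List Sym
  inst_mem : ∀ F y, inst F y ∈ C
  encode_eq : ∀ F y, (inst F y).encode = pre F ++ suf y
  width_eq : ∀ F y, (inst F y).width = s + d
  le_size : ∀ F y, s ≤ (inst F y).size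
  size_le : ∀ F y, (inst F y).size ≤ 2 ^ (10 * (s + 1))
  hasDominatingSet_iff : ∀ F y, (inst F y).HasDominatingSet ↔ ∃ x ∈ F, ∀ i, x i ≤ y i

theorem HardFamily.logb_size_le {C : Set DPInstance} {d s : ℕ} (H : HardFamily C d s)
    (hs : 0 < s) (F y) : Real.logb 2 (H.inst F y).size ≤ 10 * (s + 1) := by
  have h1 : 0 < (H.inst F y).size := hs.trans_le (H.le_size F y)
  rw [Real.logb_le_iff_le_rpow (by norm_num) (by exact_mod_cast h1)]
  have := H.size_le F y
  calc ((H.inst F y).size : ℝ) ≤ ((2 ^ (10 * (s + 1)) : ℕ) : ℝ) := by exact_mod_cast this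
    _ = (2 : ℝ) ^ ((10 * (s + 1) : ℕ) : ℝ) := by rw [Real.rpow_natCast]; push_cast; rfl
    _ = _ := by push_cast; rfl

theorem HardFamily.logb_size_nonneg {C : Set DPInstance} {d s : ℕ} (H : HardFamily C d s)
    (hs : 0 < s) (F y) : 0 ≤ Real.logb 2 (H.inst F y).size := by
  have h1 : 0 < (H.inst F y).size := hs.trans_le (H.le_size F y)
  exact Real.logb_nonneg (by norm_num) (by exact_mod_cast h1)

theorem not_decides_of_hardFamily {C : Set DPInstance} {d : ℕ}
    (hC : ∀ s, 0 < s → Nonempty (HardFamily C d s)) {b : ℝ} (hb3 : b < 3) :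
    ¬ ∃ M : DPTM, M.DecidesDominatingSet C ∧ M.UsesSpaceBigO C b := by
  classical
  have H : ∀ s, 0 < s → HardFamily C d s := fun s hs => (hC s hs).some
  rintro ⟨M, hdec, c, N, hspace⟩
  have space : ∀ s (hs : 0 < s), N ≤ s → ∀ F y,
      M.SpaceAtMost (((H s hs).pre F) ++ ((H s hs).suf y))
        (c * (b ^ (s + d) * Real.logb 2 ((H s hs).inst F y).size)) := by
    intro s hs hN F y
    have := hspace _ ((H s hs).inst_mem F y) (by rw [(H s hs).width_eq]; omega)
      (hN.trans ((H s hs).le_size F y))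
    rwa [(H s hs).encode_eq, (H s hs).width_eq] at this
  have one_le : ∀ s (hs : 0 < s), N ≤ s →
      1 ≤ c * (b ^ (s + d) * Real.logb 2 ((H s hs).inst ∅ 0).size) := by
    intro s hs hN
    have := space s hs hN ∅ 0 _ .refl
    simpa [DPTM.init] using this
  have log_nonneg : ∀ s (hs : 0 < s), 0 ≤ Real.logb 2 ((H s hs).inst ∅ 0).size :=
    fun s hs => (H s hs).logb_size_nonneg hs ∅ 0
  have e1 := one_le (N + 1) (by omega) (by omega)
  have e2 := one_le (N + 2) (by omega) (by omega)
  have l1 := log_nonneg (N + 1) (by omega)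
  have l2 := log_nonneg (N + 2) (by omega)
  set u := Real.logb 2 ((H (N + 1) (by omega)).inst ∅ 0).size
  set v := Real.logb 2 ((H (N + 2) (by omega)).inst ∅ 0).size
  -- A nonpositive base has to be excluded. At least one cell is used, so the bounds for two
  -- consecutive widths are at least `1`; their exponents have odd sum, so the product of the bounds
  -- is a nonnegative number times `b`.
  have hb : 0 < b := by
    by_contra hb
    have h1 := one_le_mul_of_one_le_of_one_le e1 e2
    have h2 : c * (b ^ (N + 1 + d) * u) * (c * (b ^ (N + 2 + d) * v)) =
        (c * b ^ (N + 1 + d)) ^ 2 * (u * v) * b := by ring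
    rw [h2] at h1
    have : 0 ≤ (c * b ^ (N + 1 + d)) ^ 2 * (u * v) := by positivity
    nlinarith
  have hc : 0 < c := by
    by_contra hc
    have : 0 ≤ b ^ (N + 1 + d) * u := by positivity
    nlinarith
  obtain ⟨a, ha⟩ := M.card_le_linear_space
  -- The new base is still below `3`, and `b' ^ s ≥ 1` absorbs additive constants.
  set b' := max b 1
  have hb'1 : 1 ≤ b' := le_max_right _ _
  -- The `2` comes from `2 * s + 1 ≤ 2 * (s + 1)`, the `10` from `logb_size_le`. One factor `s + 1`
  -- is due to the levels, the other to the logarithm.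
  obtain ⟨s, hs1, hs2⟩ := ((eventually_lt_three_pow (2 * a * (1 + c * b' ^ d * 10))
    (by linarith : 0 ≤ b') (max_lt hb3 (by norm_num))).and
      (Filter.eventually_ge_atTop (N + 1))).exists
  have hs : 0 < s := by omega
  obtain ⟨A, hA, hanti⟩ := exists_antichain s
  have hAne : A.Nonempty := by
    rw [Finset.nonempty_iff_ne_empty]
    rintro rfl
    simp at hA
  set R : ℝ := c * (b ^ (s + d) * (10 * (s + 1)))
  have hR0 : 0 ≤ R := by positivity
  have hcard := ha A hAne (H s hs).pre (H s hs).suf ⌊R⌋₊ ?_ ?_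
  · have h1 : ((3 : ℝ) ^ s) ≤ (2 * s + 1) * A.card := by exact_mod_cast hA
    have h2 : (A.card : ℝ) ≤ a * (⌊R⌋₊ + 1) := by exact_mod_cast hcard
    have h3 : (⌊R⌋₊ : ℝ) ≤ R := Nat.floor_le hR0
    have h4 : R + 1 ≤ (1 + c * b' ^ d * 10) * (s + 1) * b' ^ s := by
      have h5 : b ^ (s + d) ≤ b' ^ d * b' ^ s := by
        rw [← pow_add, add_comm d]
        exact pow_le_pow_left₀ hb.le (le_max_left _ _) _
      have h6 : 1 ≤ (s + 1 : ℝ) * b' ^ s :=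
        one_le_mul_of_one_le_of_one_le (by simp) (one_le_pow₀ hb'1)
      calc R + 1 ≤ c * (b' ^ d * b' ^ s * (10 * (s + 1))) + (s + 1 : ℝ) * b' ^ s := by
            simp only [R]
            gcongr
        _ = _ := by ring
    refine absurd hs1 (not_lt.2 ?_)
    calc (3 : ℝ) ^ s ≤ (2 * s + 1) * (a * (R + 1)) := by
          refine h1.trans ?_
          gcongr
          exact h2.trans (by gcongr)
      _ ≤ (2 * (s + 1)) * (a * ((1 + c * b' ^ d * 10) * (s + 1) * b' ^ s)) := by
          gcongr
          linarith
      _ = _ := by ring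
  · intro F hF y hy
    have h1 : (((H s hs).inst F y)).HasDominatingSet ↔ y ∈ F := by
      rw [(H s hs).hasDominatingSet_iff]
      refine ⟨?_, fun h => ⟨y, h, fun _ => le_rfl⟩⟩
      rintro ⟨x, hx, hxy⟩
      rwa [← hanti x (hF hx) y hy hxy]
    have h2 := hdec _ ((H s hs).inst_mem F y)
    rw [(H s hs).encode_eq, h1] at h2
    by_cases h : y ∈ F
    · simpa [h] using h2.1 h
    · simpa [h] using h2.2 h
  · intro F _ y _ e he
    have h1 := space s hs (by omega) F y e he
    have h2 : ((e.head + 1 : ℕ) : ℝ) ≤ R := by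
      push_cast
      refine h1.trans ?_
      simp only [R]
      gcongr
      exact (H s hs).logb_size_le hs F y
    have := Nat.le_floor h2
    exact_mod_cast this

/-! ### The graph of the lower bound and its dominating sets. -/

/-- The vertices of the graphs of the lower bound. The boundary vertices `b i`, together with
`beta₁`, `beta₂` and `hub`, separate the parts that depend on the set `F` (the vertices that carry a
vector `x`) from those that depend on the vector `y`. -/
inductive Vertex (s : ℕ) : Type
  | b (i : Fin s)
  | beta₁
  | beta₂
  | hub
  | leaf
  | q (i : Fin s)
  | n (x : Fin s → Fin 3)
  | g₁ (x : Fin s → Fin 3)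
  | g₂ (x : Fin s → Fin 3)
  | a₁ (x : Fin s → Fin 3)
  | a₂ (x : Fin s → Fin 3)
  | w (x : Fin s → Fin 3) (i : Fin s)
  deriving DecidableEq, Fintype

namespace Vertex

variable {s : ℕ}

/-- The edges of the graphs of the lower bound, each in one direction. -/
def EdgeRel (F : Finset (Fin s → Fin 3)) (y : Fin s → Fin 3) : Vertex s → Vertex s → Prop
  | n x, g₁ x' => x = x'
  | n x, g₂ x' => x = x'
  | n x, w x' _ => x = x'
  | n _, hub => True
  | a₁ x, g₁ x' => x = x' ∧ x ∈ F
  | a₁ _, hub => True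
  | a₁ _, beta₁ => True
  | a₁ x, b i => x i = 0
  | a₂ x, g₂ x' => x = x'
  | a₂ _, hub => True
  | a₂ _, beta₂ => True
  | w x i, b j => i = j ∧ x i = 2
  | w x i, hub => x i ≠ 2
  | leaf, hub => True
  | q i, hub => y i ≠ 2
  | q i, b j => i = j ∧ y i = 2
  | b i, hub => y i = 1
  | _, _ => False

/-- The graph of the lower bound given by the set `F` and the vector `y`. -/
def graph (F : Finset (Fin s → Fin 3)) (y : Fin s → Fin 3) : SimpleGraph (Vertex s) :=
  SimpleGraph.fromRel (EdgeRel F y)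

/-- The size of a dominating set that is asked for. -/
def budget (y : Fin s → Fin 3) : ℕ :=
  Fintype.card (Fin s → Fin 3) + 2 + (Finset.univ.filter fun i => y i = 2).card

variable {F : Finset (Fin s → Fin 3)} {y : Fin s → Fin 3}

theorem graph_adj {u v : Vertex s} :
    (graph F y).Adj u v ↔ u ≠ v ∧ (EdgeRel F y u v ∨ EdgeRel F y v u) := Iff.rfl

theorem graph_connected : (graph F y).Connected := by
  have hn : ∀ x, (graph F y).Reachable (n x) hub := fun x =>
    SimpleGraph.Adj.reachable (by simp [graph_adj, EdgeRel])
  have ha₁ : ∀ x, (graph F y).Reachable (a₁ x) hub := fun x =>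
    SimpleGraph.Adj.reachable (by simp [graph_adj, EdgeRel])
  have ha₂ : ∀ x, (graph F y).Reachable (a₂ x) hub := fun x =>
    SimpleGraph.Adj.reachable (by simp [graph_adj, EdgeRel])
  -- All coordinates of the vector `0` vanish, so `a₁ 0` is adjacent to every `b i`.
  have hb : ∀ i, (graph F y).Reachable (b i) hub := fun i =>
    .trans (v := a₁ 0) (SimpleGraph.Adj.reachable (by simp [graph_adj, EdgeRel])) (ha₁ 0)
  have hub_reachable : ∀ v, (graph F y).Reachable v hub := by
    intro v
    cases v with
    | b i => exact hb i
    | beta₁ =>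
      exact .trans (v := a₁ 0) (SimpleGraph.Adj.reachable (by simp [graph_adj, EdgeRel])) (ha₁ 0)
    | beta₂ =>
      exact .trans (v := a₂ 0) (SimpleGraph.Adj.reachable (by simp [graph_adj, EdgeRel])) (ha₂ 0)
    | hub => exact .rfl
    | leaf => exact SimpleGraph.Adj.reachable (by simp [graph_adj, EdgeRel])
    | q i =>
      by_cases hi : y i = 2
      · exact .trans (v := b i) (SimpleGraph.Adj.reachable (by simp [graph_adj, EdgeRel, hi]))
          (hb i)
      · exact SimpleGraph.Adj.reachable (by simp [graph_adj, EdgeRel, hi])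
    | n x => exact hn x
    | g₁ x =>
      exact .trans (v := n x) (SimpleGraph.Adj.reachable (by simp [graph_adj, EdgeRel])) (hn x)
    | g₂ x =>
      exact .trans (v := n x) (SimpleGraph.Adj.reachable (by simp [graph_adj, EdgeRel])) (hn x)
    | a₁ x => exact ha₁ x
    | a₂ x => exact ha₂ x
    | w x i =>
      exact .trans (v := n x) (SimpleGraph.Adj.reachable (by simp [graph_adj, EdgeRel])) (hn x)
  have : Nonempty (Vertex s) := ⟨hub⟩
  exact ⟨fun u v => (hub_reachable u).trans (hub_reachable v).symm⟩

/-- Every vertex is in `D` or adjacent to a vertex of `D`. -/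
def Dominates (F : Finset (Fin s → Fin 3)) (y : Fin s → Fin 3) (D : Finset (Vertex s)) : Prop :=
  ∀ v, v ∈ D ∨ ∃ u ∈ D, (graph F y).Adj u v

/-- The gadget of `x` is given `a₁ x` and `a₂ x`, all others their `n`. The inequality is used at
both ends: `y i = 0` gives `x i = 0`, so `a₁ x` dominates `b i`; and `x i = 2` gives `y i = 2`, so
the chosen `b i` dominates `w x i`. -/
theorem exists_dominates {x : Fin s → Fin 3} (hx : x ∈ F) (hxy : ∀ i, x i ≤ y i) :
    ∃ D, Dominates F y D ∧ D.card ≤ budget y := by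
  refine ⟨(Finset.univ.erase x).image n ∪ {a₁ x, a₂ x, hub} ∪
    (Finset.univ.filter fun i => y i = 2).image b, ?_, ?_⟩
  · have mem_n : ∀ x', x' ≠ x → n x' ∈ (Finset.univ.erase x).image n ∪ {a₁ x, a₂ x, hub} ∪
        (Finset.univ.filter fun i => y i = 2).image b := by simp
    have mem_a₁ : a₁ x ∈ (Finset.univ.erase x).image n ∪ {a₁ x, a₂ x, hub} ∪
        (Finset.univ.filter fun i => y i = 2).image b := by simp
    have mem_a₂ : a₂ x ∈ (Finset.univ.erase x).image n ∪ {a₁ x, a₂ x, hub} ∪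
        (Finset.univ.filter fun i => y i = 2).image b := by simp
    have mem_hub : hub ∈ (Finset.univ.erase x).image n ∪ {a₁ x, a₂ x, hub} ∪
        (Finset.univ.filter fun i => y i = 2).image b := by simp
    have mem_b : ∀ i, y i = 2 → b i ∈ (Finset.univ.erase x).image n ∪ {a₁ x, a₂ x, hub} ∪
        (Finset.univ.filter fun i => y i = 2).image b := by simp
    generalize (Finset.univ.erase x).image n ∪ {a₁ x, a₂ x, hub} ∪
        (Finset.univ.filter fun i => y i = 2).image b = D at *
    intro v
    cases v with
    | b i =>
      have : y i = 0 ∨ y i = 1 ∨ y i = 2 := by omega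
      rcases this with h | h | h
      · have hi := hxy i
        exact .inr ⟨_, mem_a₁, by simp [graph_adj, EdgeRel]; omega⟩
      · exact .inr ⟨_, mem_hub, by simp [graph_adj, EdgeRel, h]⟩
      · exact .inl (mem_b i h)
    | beta₁ => exact .inr ⟨_, mem_a₁, by simp [graph_adj, EdgeRel]⟩
    | beta₂ => exact .inr ⟨_, mem_a₂, by simp [graph_adj, EdgeRel]⟩
    | hub => exact .inl mem_hub
    | leaf => exact .inr ⟨_, mem_hub, by simp [graph_adj, EdgeRel]⟩
    | q i =>
      by_cases hi : y i = 2
      · exact .inr ⟨_, mem_b i hi, by simp [graph_adj, EdgeRel, hi]⟩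
      · exact .inr ⟨_, mem_hub, by simp [graph_adj, EdgeRel, hi]⟩
    | n x' => exact .inr ⟨_, mem_hub, by simp [graph_adj, EdgeRel]⟩
    | g₁ x' =>
      by_cases h : x' = x
      · exact .inr ⟨_, mem_a₁, by simp [graph_adj, EdgeRel, h, hx]⟩
      · exact .inr ⟨_, mem_n x' h, by simp [graph_adj, EdgeRel]⟩
    | g₂ x' =>
      by_cases h : x' = x
      · exact .inr ⟨_, mem_a₂, by simp [graph_adj, EdgeRel, h]⟩
      · exact .inr ⟨_, mem_n x' h, by simp [graph_adj, EdgeRel]⟩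
    | a₁ x' => exact .inr ⟨_, mem_hub, by simp [graph_adj, EdgeRel]⟩
    | a₂ x' => exact .inr ⟨_, mem_hub, by simp [graph_adj, EdgeRel]⟩
    | w x' i =>
      by_cases h : x' = x
      · subst h
        by_cases hi : x' i = 2
        · have := hxy i
          exact .inr ⟨_, mem_b i (by omega), by simp [graph_adj, EdgeRel, hi]⟩
        · exact .inr ⟨_, mem_hub, by simp [graph_adj, EdgeRel, hi]⟩
      · exact .inr ⟨_, mem_n x' h, by simp [graph_adj, EdgeRel]⟩
  · have h1 : ((Finset.univ.erase x).image (n (s := s))).card + 1 ≤ Fintype.card (Fin s → Fin 3) := by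
      have := Finset.card_image_le (s := Finset.univ.erase x) (f := n (s := s))
      have h2 := Finset.card_erase_add_one (Finset.mem_univ x)
      rw [Finset.card_univ] at h2
      omega
    have h2 := Finset.card_image_le (s := Finset.univ.filter fun i => y i = 2) (f := b (s := s))
    have h3 : ({a₁ x, a₂ x, hub} : Finset (Vertex s)).card ≤ 3 := Finset.card_le_three
    have h4 := Finset.card_union_le ((Finset.univ.erase x).image n ∪ {a₁ x, a₂ x, hub})
      ((Finset.univ.filter fun i => y i = 2).image b)
    have h5 := Finset.card_union_le ((Finset.univ.erase x).image n) {a₁ x, a₂ x, hub}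
    unfold budget
    omega

/-- The parts of the vertex set that are counted separately. -/
def part : Vertex s → (Fin s → Fin 3) ⊕ Unit ⊕ Fin s ⊕ Bool
  | b i => .inr (.inr (.inl i))
  | q i => .inr (.inr (.inl i))
  | beta₁ => .inr (.inr (.inr true))
  | beta₂ => .inr (.inr (.inr false))
  | hub => .inr (.inl ())
  | leaf => .inr (.inl ())
  | n x => .inl x
  | g₁ x => .inl x
  | g₂ x => .inl x
  | a₁ x => .inl x
  | a₂ x => .inl x
  | w x _ => .inl x

section

variable {D : Finset (Vertex s)}

theorem Dominates.g₁ (h : Dominates F y D) (x) :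
    Vertex.g₁ x ∈ D ∨ n x ∈ D ∨ (a₁ x ∈ D ∧ x ∈ F) := by
  rcases h (.g₁ x) with h | ⟨u, hu, ha⟩
  · exact .inl h
  · cases u <;> simp [graph_adj, EdgeRel] at ha
    · exact .inr (.inl (ha ▸ hu))
    · obtain ⟨rfl, hF⟩ := ha
      exact .inr (.inr ⟨hu, hF⟩)

theorem Dominates.g₂ (h : Dominates F y D) (x) :
    Vertex.g₂ x ∈ D ∨ n x ∈ D ∨ a₂ x ∈ D := by
  rcases h (.g₂ x) with h | ⟨u, hu, ha⟩
  · exact .inl h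
  · cases u <;> simp [graph_adj, EdgeRel] at ha
    · exact .inr (.inl (ha ▸ hu))
    · exact .inr (.inr (ha ▸ hu))

theorem Dominates.leaf (h : Dominates F y D) : Vertex.leaf ∈ D ∨ hub ∈ D := by
  rcases h .leaf with h | ⟨u, hu, ha⟩
  · exact .inl h
  · cases u <;> simp [graph_adj, EdgeRel] at ha
    exact .inr hu

theorem Dominates.q (h : Dominates F y D) {i} (hi : y i = 2) : Vertex.q i ∈ D ∨ b i ∈ D := by
  rcases h (.q i) with h | ⟨u, hu, ha⟩
  · exact .inl h
  · cases u <;> simp [graph_adj, EdgeRel, hi] at ha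
    exact .inr (ha ▸ hu)

theorem Dominates.beta₁ (h : Dominates F y D) : Vertex.beta₁ ∈ D ∨ ∃ x, a₁ x ∈ D := by
  rcases h .beta₁ with h | ⟨u, hu, ha⟩
  · exact .inl h
  · cases u <;> simp [graph_adj, EdgeRel] at ha
    exact .inr ⟨_, hu⟩

theorem Dominates.beta₂ (h : Dominates F y D) : Vertex.beta₂ ∈ D ∨ ∃ x, a₂ x ∈ D := by
  rcases h .beta₂ with h | ⟨u, hu, ha⟩
  · exact .inl h
  · cases u <;> simp [graph_adj, EdgeRel] at ha
    exact .inr ⟨_, hu⟩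

theorem Dominates.b (h : Dominates F y D) {i} (hi : y i = 0) :
    Vertex.b i ∈ D ∨ (∃ x, a₁ x ∈ D ∧ x i = 0) ∨ ∃ x, w x i ∈ D := by
  rcases h (.b i) with h | ⟨u, hu, ha⟩
  · exact .inl h
  · cases u <;> simp [graph_adj, EdgeRel, hi] at ha
    · obtain ⟨rfl, ha⟩ := ha
      simp [hi] at ha
    · exact .inr (.inl ⟨_, hu, ha⟩)
    · obtain ⟨rfl, ha⟩ := ha
      exact .inr (.inr ⟨_, hu⟩)

theorem Dominates.w (h : Dominates F y D) {x} {i} (hi : x i = 2) :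
    Vertex.w x i ∈ D ∨ n x ∈ D ∨ Vertex.b i ∈ D := by
  rcases h (.w x i) with h | ⟨u, hu, ha⟩
  · exact .inl h
  · cases u <;> simp [graph_adj, EdgeRel, hi] at ha
    · exact .inr (.inr (ha ▸ hu))
    · exact .inr (.inl (ha ▸ hu))

theorem Dominates.exists_le (h : Dominates F y D) (hD : D.card ≤ budget y) :
    ∃ x ∈ F, ∀ i, x i ≤ y i := by
  let cnt := fun p => (D.filter fun v => part v = p).card
  have hsum : D.card = ∑ p, cnt p :=
    Finset.card_eq_sum_card_fiberwise fun v _ => Finset.mem_univ (part v)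
  simp only [Fintype.sum_sum_type, Finset.univ_unique, Finset.sum_singleton,
    Fintype.sum_bool] at hsum
  have pos : ∀ v ∈ D, 1 ≤ cnt (part v) := fun v hv =>
    Finset.card_pos.2 ⟨v, by simp [hv]⟩
  have two : ∀ u ∈ D, ∀ v ∈ D, u ≠ v → part u = part v → 2 ≤ cnt (part v) := by
    intro u hu v hv huv hp
    exact Finset.one_lt_card.2 ⟨u, by simp [hu, hp], v, by simp [hv], huv⟩
  have three : ∀ u ∈ D, ∀ v ∈ D, ∀ w ∈ D, u ≠ v → u ≠ w → v ≠ w → part u = part w →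
      part v = part w → 3 ≤ cnt (part w) := by
    intro u hu v hv w hw h1 h2 h3 h4 h5
    exact Finset.two_lt_card.2 ⟨u, by simp [hu, h4], v, by simp [hv, h5], w, by simp [hw],
      h1, h2, h3⟩
  have hx : ∀ x, 1 ≤ cnt (.inl x) := by
    intro x
    rcases h.g₁ x with h | h | ⟨h, -⟩ <;> exact pos _ h
  have hh : 1 ≤ cnt (.inr (.inl ())) := by
    rcases h.leaf with h | h <;> exact pos _ h
  have hi : ∀ i, (if y i = 2 then 1 else 0) ≤ cnt (.inr (.inr (.inl i))) := by
    intro i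
    split_ifs with hy
    · rcases h.q hy with h | h <;> exact pos _ h
    · exact Nat.zero_le _
  have sum_x : ∑ x, cnt (.inl x) = Fintype.card (Fin s → Fin 3) + ∑ x, (cnt (.inl x) - 1) := by
    have : ∀ x, cnt (.inl x) = 1 + (cnt (.inl x) - 1) := fun x => by have := hx x; omega
    rw [Finset.sum_congr rfl fun x _ => this x, Finset.sum_add_distrib]
    simp
  have sum_i : ∑ i, cnt (.inr (.inr (.inl i))) = (Finset.univ.filter fun i => y i = 2).card +
      ∑ i, (cnt (.inr (.inr (.inl i))) - if y i = 2 then 1 else 0) := by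
    have : ∀ i, cnt (.inr (.inr (.inl i))) = (if y i = 2 then 1 else 0) +
        (cnt (.inr (.inr (.inl i))) - if y i = 2 then 1 else 0) :=
      fun i => by have := hi i; omega
    rw [Finset.sum_congr rfl fun i _ => this i, Finset.sum_add_distrib, Finset.card_filter]
  -- Each gadget, the pair `hub`, `leaf`, and each pair `q i`, `b i` with `y i = 2` need a vertex of
  -- their own. Exactly one unit of the budget remains.
  have slack : ∑ x, (cnt (.inl x) - 1) +
      ∑ i, (cnt (.inr (.inr (.inl i))) - if y i = 2 then 1 else 0) +
      cnt (.inr (.inr (.inr true))) + cnt (.inr (.inr (.inr false))) ≤ 1 := by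
    have hh' : 1 ≤ cnt (.inr (.inl default)) := hh
    unfold budget at hD
    omega
  -- Only `n x` takes care of both `g₁ x` and `g₂ x`.
  have only_n : ∀ x, cnt (.inl x) = 1 → ∀ v ∈ D, part v = .inl x → v = n x := by
    intro x hx1 v hv hvx
    have eq : ∀ u ∈ D, part u = .inl x → u = v := by
      intro u hu hux
      by_contra huv
      have := two u hu v hv huv (hux.trans hvx.symm)
      rw [hvx] at this
      omega
    rcases h.g₁ x with h1 | h1 | ⟨h1, -⟩
    · rcases h.g₂ x with h2 | h2 | h2
      · have := (eq _ h1 rfl).trans (eq _ h2 rfl).symm; simp at this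
      · exact (eq _ h2 rfl).symm
      · have := (eq _ h1 rfl).trans (eq _ h2 rfl).symm; simp at this
    · exact (eq _ h1 rfl).symm
    · rcases h.g₂ x with h2 | h2 | h2
      · have := (eq _ h1 rfl).trans (eq _ h2 rfl).symm; simp at this
      · exact (eq _ h2 rfl).symm
      · have := (eq _ h1 rfl).trans (eq _ h2 rfl).symm; simp at this
  -- Otherwise no `a₁` or `a₂` is chosen, and `beta₁` and `beta₂` must both be chosen, which exceeds
  -- the slack.
  have ex : ∃ x₀, 2 ≤ cnt (.inl x₀) := by
    by_contra! hlt
    have one : ∀ x, cnt (.inl x) = 1 := fun x => by have := hx x; have := hlt x; omega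
    have b1 : 1 ≤ cnt (.inr (.inr (.inr true))) := by
      rcases h.beta₁ with h1 | ⟨x, h1⟩
      · exact pos _ h1
      · have := only_n x (one x) _ h1 rfl; simp at this
    have b2 : 1 ≤ cnt (.inr (.inr (.inr false))) := by
      rcases h.beta₂ with h1 | ⟨x, h1⟩
      · exact pos _ h1
      · have := only_n x (one x) _ h1 rfl; simp at this
    omega
  obtain ⟨x₀, hx₀⟩ := ex
  have le_x₀ := Finset.single_le_sum (f := fun x => cnt (.inl x) - 1) (fun _ _ => Nat.zero_le _)
    (Finset.mem_univ x₀)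
  beta_reduce at le_x₀
  have others : ∀ x, x ≠ x₀ → cnt (.inl x) = 1 := by
    intro x hxx
    have h1 := Finset.sum_le_sum_of_subset (f := fun x => cnt (.inl x) - 1)
      (Finset.subset_univ {x, x₀})
    rw [Finset.sum_pair hxx] at h1
    have := hx x
    omega
  -- The slack is already spent at `x₀`, so `b i` is affordable only where the budget provides a
  -- vertex for `q i`.
  have b_mem : ∀ i, Vertex.b i ∈ D → y i = 2 := by
    intro i hbi
    by_contra hy
    have h1 := pos _ hbi
    have h2 := Finset.single_le_sum
      (f := fun i => cnt (.inr (.inr (.inl i))) - if y i = 2 then 1 else 0)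
      (fun _ _ => Nat.zero_le _) (Finset.mem_univ i)
    simp only [hy, if_false] at h2
    change 1 ≤ cnt (.inr (.inr (.inl i))) at h1
    omega
  have ha₁ : a₁ x₀ ∈ D := by
    rcases h.beta₁ with h1 | ⟨x, h1⟩
    · have := pos _ h1
      change 1 ≤ cnt (.inr (.inr (.inr true))) at this
      omega
    · by_cases hxx : x = x₀
      · rwa [← hxx]
      · have := only_n x (others x hxx) _ h1 rfl; simp at this
  have ha₂ : a₂ x₀ ∈ D := by
    rcases h.beta₂ with h1 | ⟨x, h1⟩
    · have := pos _ h1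
      change 1 ≤ cnt (.inr (.inr (.inr false))) at this
      omega
    · by_cases hxx : x = x₀
      · rwa [← hxx]
      · have := only_n x (others x hxx) _ h1 rfl; simp at this
  have only_a : ∀ v ∈ D, part v = .inl x₀ → v = a₁ x₀ ∨ v = a₂ x₀ := by
    intro v hv hvx
    by_contra! hne
    have := three _ ha₁ _ ha₂ v hv (by simp) hne.1.symm hne.2.symm hvx.symm hvx.symm
    rw [hvx] at this
    omega
  have no_w : ∀ x i, Vertex.w x i ∉ D := by
    intro x i hw
    by_cases hxx : x = x₀
    · rcases only_a _ hw (by rw [← hxx]; rfl) with h | h <;> simp at h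
    · have := only_n x (others x hxx) _ hw rfl; simp at this
  have no_n : n x₀ ∉ D := fun hn => by rcases only_a _ hn rfl with h | h <;> simp at h
  refine ⟨x₀, ?_, fun i => ?_⟩
  · rcases h.g₁ x₀ with h | h | h
    · rcases only_a _ h rfl with h | h <;> simp at h
    · exact absurd h no_n
    · exact h.2
  · by_cases h0 : y i = 0
    · rcases h.b h0 with h1 | ⟨x, h1, h2⟩ | ⟨x, h1⟩
      · have := b_mem i h1; omega
      · by_cases hxx : x = x₀
        · rw [← hxx, h2]; exact Fin.zero_le _
        · have := only_n x (others x hxx) _ h1 rfl; simp at this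
      · exact absurd h1 (no_w x i)
    · by_cases h2 : x₀ i = 2
      · rcases h.w h2 with h1 | h1 | h1
        · exact absurd h1 (no_w _ i)
        · exact absurd h1 no_n
        · rw [b_mem i h1, h2]
      · omega

end

/-! ### Vertex names -/

/-- The names of the vertices. -/
noncomputable def name (s : ℕ) : Vertex s ≃ Fin (Fintype.card (Vertex s)) :=
  Fintype.equivFin _

/-- The graph of the lower bound on the vertex names. -/
noncomputable def namedGraph (F : Finset (Fin s → Fin 3)) (y : Fin s → Fin 3) :
    SimpleGraph (Fin (Fintype.card (Vertex s))) :=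
  (graph F y).comap (name s).symm

theorem namedGraph_adj {u v} :
    (namedGraph F y).Adj u v ↔ (graph F y).Adj ((name s).symm u) ((name s).symm v) := Iff.rfl

theorem namedGraph_connected : (namedGraph F y).Connected := by
  have : (graph F y).Connected := graph_connected
  rwa [← SimpleGraph.Iso.connected_iff (SimpleGraph.Iso.comap (name s).symm (graph F y))] at this

theorem exists_isDominatingSet_iff :
    (∃ S, IsDominatingSet (namedGraph F y) S ∧ S.card ≤ budget y) ↔ ∃ x ∈ F, ∀ i, x i ≤ y i := by
  constructor
  · rintro ⟨S, hS, hc⟩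
    refine Dominates.exists_le (D := S.map (name s).symm.toEmbedding) (fun v => ?_) (by simpa)
    rcases hS (name s v) with h | ⟨u, hu, ha⟩
    · exact .inl (Finset.mem_map.2 ⟨_, h, by simp⟩)
    · exact .inr ⟨_, Finset.mem_map_of_mem _ hu, by simpa [namedGraph_adj] using ha⟩
  · rintro ⟨x, hx, hxy⟩
    obtain ⟨D, hD, hc⟩ := exists_dominates hx hxy
    refine ⟨D.map (name s).toEmbedding, fun v => ?_, by simpa⟩
    rcases hD ((name s).symm v) with h | ⟨u, hu, ha⟩
    · exact .inl (Finset.mem_map.2 ⟨_, h, by simp⟩)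
    · exact .inr ⟨_, Finset.mem_map_of_mem _ hu, by simpa [namedGraph_adj] using ha⟩

/-- Whether a vertex belongs to the gadget of a vector. -/
def IsGadget : Vertex s → Prop
  | n _ | g₁ _ | g₂ _ | a₁ _ | a₂ _ | w _ _ => True
  | _ => False

/-- The vector `y` affects only edges at some `q i` and edges from `b i` to `hub`. -/
theorem graph_adj_congr_right {u v : Vertex s} (h : u.IsGadget ∨ v.IsGadget) (y y') :
    (graph F y).Adj u v ↔ (graph F y').Adj u v := by
  cases u <;> cases v <;> simp_all [graph_adj, EdgeRel, IsGadget]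

/-- The set `F` affects only the edges from `a₁ x` to `g₁ x`. -/
theorem graph_adj_congr_left {u v : Vertex s} (hu : ¬ u.IsGadget) (hv : ¬ v.IsGadget) (F F') :
    (graph F y).Adj u v ↔ (graph F' y).Adj u v := by
  cases u <;> cases v <;> simp_all [graph_adj, EdgeRel, IsGadget]

end Vertex

/-! ### Locality of the encoding -/

section Encoding

variable {n : ℕ} {G G' : SimpleGraph (Fin n)}

theorem newEdges_congr {P B : List (Fin n)}
    (h : ∀ u ∈ B, ∀ v ∈ B, ¬ (u ∈ P ∧ v ∈ P) → (G.Adj u v ↔ G'.Adj u v)) :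
    newEdges G P B = newEdges G' P B := by
  unfold newEdges
  refine List.filter_congr fun e _ => ?_
  rw [decide_eq_decide]
  have := h _ (List.get_mem B e.1) _ (List.get_mem B e.2)
  tauto

theorem encodeNode_congr {P B : List (Fin n)} (d : ℕ)
    (h : ∀ u ∈ B, ∀ v ∈ B, ¬ (u ∈ P ∧ v ∈ P) → (G.Adj u v ↔ G'.Adj u v)) :
    encodeNode G P B d = encodeNode G' P B d := by
  unfold encodeNode
  rw [newEdges_congr h]

theorem encodeTree_node (P B : List (Fin n)) (cs : List (RTree (List (Fin n)))) :
    encodeTree G P (.node B cs) =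
      (cs.flatMap fun t => encodeTree G B t) ++ encodeNode G P B cs.length := by
  rw [encodeTree]

end Encoding

namespace RTree

variable {α β : Type}

theorem postorder_node (a : α) (cs : List (RTree α)) :
    (node a cs).postorder = (cs.flatMap fun t => t.postorder) ++ [node a cs] := by
  rw [postorder]

theorem labels_node (a : α) (cs : List (RTree α)) :
    (node a cs).labels = (cs.flatMap fun t => t.labels) ++ [a] := by
  simp [labels, postorder_node, label, List.map_flatMap]

theorem map_node (f : α → β) (a : α) (cs : List (RTree α)) :
    (node a cs).map f = node (f a) (cs.map fun t => t.map f) := by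
  rw [map]

theorem height_node (a : α) (cs : List (RTree α)) :
    (node a cs).height = 1 + (cs.map fun t => t.height).foldr max 0 := by
  rw [height]

theorem rootPathsAux_node (P : List α) (a : α) (cs : List (RTree α)) :
    (node a cs).rootPathsAux P = node (P ++ [a]) (cs.map fun t => t.rootPathsAux (P ++ [a])) := by
  rw [rootPathsAux]

theorem length_labels (t : RTree α) : t.labels.length = t.size := by simp [labels, size]

theorem size_node (a : α) (cs : List (RTree α)) :
    (node a cs).size = (cs.map size).sum + 1 := by
  simp only [size, postorder_node, List.length_append, List.length_flatMap, List.length_singleton]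
  rfl

theorem size_rootPathsAux : ∀ (t : RTree α) (P : List α), (t.rootPathsAux P).size = t.size
  | node a cs, P => by
    rw [rootPathsAux_node, size_node, size_node, List.map_map]
    congr 2
    refine List.map_congr_left fun t _ => ?_
    exact size_rootPathsAux t _

theorem self_mem_postorder (t : RTree α) : t ∈ t.postorder := by
  cases t
  simp [postorder_node]

/-- Each label of the tree of root paths below `P` consists of `P` and of labels of the tree. -/
theorem mem_labels_rootPathsAux : ∀ (t : RTree α) (P : List α), ∀ B ∈ (t.rootPathsAux P).labels,
    P ⊆ B ∧ ∀ u ∈ B, u ∈ P ∨ u ∈ t.labels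
  | node a cs, P, B, hB => by
    simp only [rootPathsAux_node, labels_node, List.mem_append, List.mem_flatMap, List.mem_map,
      List.mem_singleton] at hB
    rcases hB with ⟨_, ⟨t, ht, rfl⟩, hB⟩ | rfl
    · obtain ⟨h1, h2⟩ := mem_labels_rootPathsAux t _ B hB
      refine ⟨fun u hu => h1 (List.mem_append_left _ hu), fun u hu => ?_⟩
      rcases h2 u hu with h | h
      · rcases List.mem_append.1 h with h | h
        · exact .inl h
        · exact .inr (by simp [labels_node, List.mem_singleton.1 h])
      · refine .inr ?_
        rw [labels_node]
        exact List.mem_append_left _ (List.mem_flatMap.2 ⟨t, ht, h⟩)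
    · refine ⟨List.subset_append_left _ _, fun u hu => ?_⟩
      rcases List.mem_append.1 hu with h | h
      · exact .inl h
      · exact .inr (by simp [labels_node, List.mem_singleton.1 h])

theorem foldr_max_eq {l : List ℕ} {m : ℕ} (h : ∀ a ∈ l, a ≤ m) (hm : m ∈ l) :
    l.foldr max 0 = m := by
  induction l with
  | nil => simp at hm
  | cons a l ih =>
    have ha := h a (by simp)
    have hle : l.foldr max 0 ≤ m := by
      clear ih hm ha
      induction l with
      | nil => simp
      | cons b l ih =>
        have hb := h b (by simp)
        have := ih fun c hc => h c (by
          rcases List.mem_cons.1 hc with hc | hc <;> simp [hc])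
        simp only [List.foldr_cons]
        omega
    rcases List.mem_cons.1 hm with rfl | hm
    · simp only [List.foldr_cons]
      omega
    · have := ih (fun c hc => h c (by simp [hc])) hm
      simp only [List.foldr_cons]
      omega

end RTree

/-- The code of a tree whose separators all contain `K` does not depend on the edges inside `K`. -/
theorem encodeTree_congr {n : ℕ} {G G' : SimpleGraph (Fin n)} {K U : Set (Fin n)}
    (hG : ∀ u ∈ U, ∀ v ∈ U, ¬ (u ∈ K ∧ v ∈ K) → (G.Adj u v ↔ G'.Adj u v)) :
    ∀ (t : RTree (List (Fin n))) (P : List (Fin n)), (∀ u ∈ K, u ∈ P) →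
      (∀ B ∈ t.labels, (∀ u ∈ K, u ∈ B) ∧ ∀ u ∈ B, u ∈ U) →
      encodeTree G P t = encodeTree G' P t
  | .node B cs, P, hP, hL => by
    rw [encodeTree_node, encodeTree_node]
    have hB := hL B (by simp [RTree.labels_node])
    congr 1
    · refine List.flatMap_congr fun t ht => encodeTree_congr hG t B hB.1 fun C hC => hL C ?_
      rw [RTree.labels_node]
      exact List.mem_append_left _ (List.mem_flatMap.2 ⟨t, ht, hC⟩)
    -- An edge inside `K` also lies in the parent's separator, so it is not listed at this node.
    · exact encodeNode_congr _ fun u hu v hv huv =>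
        hG u (hB.2 u hu) v (hB.2 v hv) fun h => huv ⟨hP u h.1, hP v h.2⟩

/-! ### Paths: addresses, connected sets of nodes, and splitting the code. -/

namespace RTree

variable {α β : Type}

/-- The path with the given labels, listed from the root downwards. -/
def chain : α → List α → RTree α
  | a, [] => node a []
  | a, b :: l => node a [chain b l]

theorem labels_chain : ∀ (a : α) (l : List α), (chain a l).labels = (a :: l).reverse
  | a, [] => by simp [chain, labels_node]
  | a, b :: l => by simp [chain, labels_node, labels_chain b l]

theorem map_chain (f : α → β) : ∀ (a : α) (l : List α),
    (chain a l).map f = chain (f a) (l.map f)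
  | a, [] => by simp [chain, map_node]
  | a, b :: l => by simp [chain, map_node, map_chain f b l]

theorem label_chain (a : α) (l : List α) : (chain a l).label = a := by
  cases l <;> rfl

theorem isPath_chain : ∀ (a : α) (l : List α), (chain a l).IsPath
  | a, [] => by simp [chain, IsPath, postorder_node, children]
  | a, b :: l => by
    have := isPath_chain b l
    simp only [IsPath, chain, postorder_node, List.flatMap_cons, List.flatMap_nil,
      List.append_nil, List.mem_append, List.mem_singleton] at this ⊢
    rintro t (h | rfl)
    · exact this t h
    · simp [children]

theorem subtreeAt_chain : ∀ (a : α) (l : List α) (j : ℕ) (c : α), (a :: l)[j]? = some c →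
    ∃ t, (chain a l).subtreeAt (List.replicate j 0) = some t ∧ t.label = c
  | a, l, 0, c, h => by
    refine ⟨chain a l, by simp [subtreeAt], ?_⟩
    rw [label_chain]
    simpa using h
  | a, [], j + 1, c, h => by simp at h
  | a, b :: l, j + 1, c, h => by
    obtain ⟨t, h1, h2⟩ := subtreeAt_chain b l j c (by simpa using h)
    exact ⟨t, by simpa [chain, List.replicate_succ, subtreeAt, children] using h1, h2⟩

/-- Together with `subtreeAt_chain` this identifies the addresses in a path with the positions in
its list of labels. -/
theorem eq_replicate_of_subtreeAt_chain : ∀ (a : α) (l : List α) (p : List ℕ) (t : RTree α),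
    (chain a l).subtreeAt p = some t →
    ∃ j, p = List.replicate j 0 ∧ (a :: l)[j]? = some t.label
  | a, l, [], t, h => by
    refine ⟨0, rfl, ?_⟩
    rw [subtreeAt, Option.some_inj] at h
    simp [← h, label_chain]
  | a, [], i :: p, t, h => by simp [chain, subtreeAt, children] at h
  | a, b :: l, i :: p, t, h => by
    cases i with
    | succ i => simp [chain, subtreeAt, children] at h
    | zero =>
      obtain ⟨j, rfl, h2⟩ := eq_replicate_of_subtreeAt_chain b l p t
        (by simpa [chain, subtreeAt, children] using h)
      exact ⟨j + 1, by simp [List.replicate_succ], by simpa using h2⟩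

end RTree

/-- The members of `l` with the property `p` are consecutive. -/
def Contiguous {α : Type} (p : α → Prop) (l : List α) : Prop :=
  ∃ l₁ l₂ l₃, l = l₁ ++ l₂ ++ l₃ ∧ (∀ a ∈ l₁, ¬ p a) ∧ (∀ a ∈ l₂, p a) ∧ ∀ a ∈ l₃, ¬ p a

namespace Contiguous

variable {α β : Type} {p : α → Prop}

theorem of_forall {l : List α} (h : ∀ a ∈ l, p a) : Contiguous p l :=
  ⟨[], l, [], by simp, by simp, h, by simp⟩

theorem append_left {l : List α} (h : Contiguous p l) {l' : List α} (h' : ∀ a ∈ l', ¬ p a) :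
    Contiguous p (l' ++ l) := by
  obtain ⟨l₁, l₂, l₃, rfl, h1, h2, h3⟩ := h
  refine ⟨l' ++ l₁, l₂, l₃, by simp, fun a ha => ?_, h2, h3⟩
  rcases List.mem_append.1 ha with ha | ha
  exacts [h' a ha, h1 a ha]

theorem append_right {l : List α} (h : Contiguous p l) {l' : List α} (h' : ∀ a ∈ l', ¬ p a) :
    Contiguous p (l ++ l') := by
  obtain ⟨l₁, l₂, l₃, rfl, h1, h2, h3⟩ := h
  refine ⟨l₁, l₂, l₃ ++ l', by simp, h1, h2, fun a ha => ?_⟩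
  rcases List.mem_append.1 ha with ha | ha
  exacts [h3 a ha, h' a ha]

theorem flatMap {l : List β} (hl : l.Nodup) {b : β} (hb : b ∈ l) {f : β → List α}
    (hf : Contiguous p (f b)) (h : ∀ c, c ≠ b → ∀ a ∈ f c, ¬ p a) :
    Contiguous p (l.flatMap f) := by
  obtain ⟨l₁, l₂, rfl⟩ := List.append_of_mem hb
  rw [List.nodup_middle, List.nodup_cons] at hl
  simp only [List.mem_append, not_or] at hl
  rw [List.flatMap_append, List.flatMap_cons]
  refine (hf.append_right fun a ha => ?_).append_left fun a ha => ?_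
  all_goals
    obtain ⟨c, hc, ha⟩ := List.mem_flatMap.1 ha
    refine h c ?_ a ha
    rintro rfl
    tauto

theorem map {l : List β} (hl : l.Nodup) {b : β} (hb : b ∈ l) {f : β → α}
    (hf : p (f b)) (h : ∀ c, c ≠ b → ¬ p (f c)) : Contiguous p (l.map f) := by
  rw [List.map_eq_flatMap]
  exact flatMap hl hb (of_forall (by simpa using hf)) fun c hc a ha => by
    rw [List.mem_singleton.1 ha]
    exact h c hc

theorem of_map {l : List β} {f : β → α} (h : Contiguous (fun b => p (f b)) l) :
    Contiguous p (l.map f) := by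
  obtain ⟨l₁, l₂, l₃, rfl, h1, h2, h3⟩ := h
  refine ⟨l₁.map f, l₂.map f, l₃.map f, by simp, ?_, ?_, ?_⟩ <;> simpa

/-- On a path, consecutive nodes form a connected set. -/
theorem preconnected_chain {a : α} {l : List α} (h : Contiguous p (a :: l)) :
    (addressGraph.induce
      {r | ∃ t, (RTree.chain a l).subtreeAt r = some t ∧ p t.label}).Preconnected := by
  obtain ⟨l₁, l₂, l₃, hl, h1, h2, h3⟩ := h
  have mem : ∀ j, j < l₂.length → List.replicate (l₁.length + j) 0 ∈
      {r | ∃ t, (RTree.chain a l).subtreeAt r = some t ∧ p t.label} := by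
    intro j hj
    obtain ⟨t, ht, hc⟩ := RTree.subtreeAt_chain a l (l₁.length + j) (l₂[j]) (by
      rw [hl, List.append_assoc, List.getElem?_append_right (by omega),
        List.getElem?_append_left (by omega)]
      simp [hj])
    exact ⟨t, ht, by rw [hc]; exact h2 _ (List.getElem_mem hj)⟩
  have reach : ∀ j (hj : j < l₂.length), (addressGraph.induce _).Reachable
      ⟨_, mem 0 (by omega)⟩ ⟨_, mem j hj⟩ := by
    intro j
    induction j with
    | zero => exact fun hj => .rfl
    | succ j ih =>
      intro hj
      refine (ih (by omega)).trans (SimpleGraph.Adj.reachable ?_)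
      rw [SimpleGraph.comap_adj]
      refine ⟨fun h => ?_, .inl ⟨0, ?_⟩⟩
      · have := congrArg List.length h
        simp at this
      · simp [← add_assoc, List.replicate_succ']
  have all : ∀ r : {r | ∃ t, (RTree.chain a l).subtreeAt r = some t ∧ p t.label},
      ∃ j, ∃ hj : j < l₂.length, r = ⟨_, mem j hj⟩ := by
    rintro ⟨r, t, ht, hp⟩
    obtain ⟨j, rfl, hj⟩ := RTree.eq_replicate_of_subtreeAt_chain a l r t ht
    rw [hl] at hj
    have hj1 : l₁.length ≤ j := by
      by_contra hlt
      rw [List.append_assoc, List.getElem?_append_left (by omega)] at hj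
      exact h1 _ (List.mem_of_getElem? hj) hp
    have hj2 : j < l₁.length + l₂.length := by
      by_contra hlt
      rw [List.getElem?_append_right (by simp; omega)] at hj
      exact h3 _ (List.mem_of_getElem? hj) hp
    refine ⟨j - l₁.length, by omega, ?_⟩
    simp only [Subtype.mk.injEq]
    congr 1
    omega
  intro r r'
  obtain ⟨j, hj, rfl⟩ := all r
  obtain ⟨j', hj', rfl⟩ := all r'
  exact (reach j hj).symm.trans (reach j' hj')

end Contiguous

/-- The codes of the nodes of a path with at least one node below the listed ones; the nodes are
listed from the root downwards. -/
noncomputable def chainCode {n : ℕ} (G : SimpleGraph (Fin n)) :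
    List (Fin n) → List (List (Fin n)) → List Sym
  | _, [] => []
  | P, B :: l => chainCode G B l ++ encodeNode G P B 1

theorem chainCode_congr {n : ℕ} {G G' : SimpleGraph (Fin n)} :
    ∀ (P : List (Fin n)) (l : List (List (Fin n))),
      (∀ B ∈ l, ∀ u ∈ B, ∀ v ∈ B, (G.Adj u v ↔ G'.Adj u v)) →
      chainCode G P l = chainCode G' P l
  | _, [], _ => rfl
  | P, B :: l, h => by
    rw [chainCode, chainCode, chainCode_congr B l fun C hC => h C (List.mem_cons_of_mem _ hC),
      encodeNode_congr 1 fun u hu v hv _ => h B List.mem_cons_self u hu v hv]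

/-- Post-order writes the deep end first, so cutting the path above `C` cuts the code into two
consecutive words. -/
theorem encodeTree_chain_append {n : ℕ} (G : SimpleGraph (Fin n)) (C : List (Fin n))
    (l' : List (List (Fin n))) : ∀ (P B : List (Fin n)) (l : List (List (Fin n))),
    encodeTree G P (RTree.chain B (l ++ C :: l')) =
      encodeTree G ((B :: l).getLast (by simp)) (RTree.chain C l') ++ chainCode G P (B :: l)
  | P, B, [] => by simp [RTree.chain, encodeTree_node, chainCode]
  | P, B, D :: l => by
    rw [List.cons_append, RTree.chain, encodeTree_node, chainCode]
    simp [encodeTree_chain_append G C l' B D l]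

/-! ### The path decomposition -/

namespace Vertex

variable {s : ℕ}

/-- The vertices that separate the gadgets from each other and from the rest of the graph. -/
def core (s : ℕ) : Finset (Vertex s) := Finset.univ.image b ∪ {beta₁, beta₂, hub}

theorem card_core : (core s).card = s + 3 := by
  rw [core, Finset.card_union_of_disjoint, Finset.card_image_of_injective]
  · simp
  · intro i j h
    simpa using h
  · simp [Finset.disjoint_left]

/-- A bag of the gadget of `x`. -/
def gadgetBag (x : Fin s → Fin 3) (i : Fin s) : Finset (Vertex s) :=
  core s ∪ {n x, g₁ x, g₂ x, a₁ x, a₂ x, w x i}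

theorem card_gadgetBag (x : Fin s → Fin 3) (i : Fin s) : (gadgetBag x i).card = s + 9 := by
  rw [gadgetBag, Finset.card_union_of_disjoint, card_core]
  · simp
  · simp [Finset.disjoint_left, core]

/-- The bags of all gadgets. -/
noncomputable def gadgetBags (s : ℕ) : List (Finset (Vertex s)) :=
  Finset.univ.toList.flatMap fun x => (List.finRange s).map (gadgetBag x)

/-- The bags that contain no gadget vertex, except for the root. -/
def testBags (s : ℕ) : List (Finset (Vertex s)) :=
  (List.finRange s).map fun i => insert (q i) (core s)

theorem mem_gadgetBags {B : Finset (Vertex s)} :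
    B ∈ gadgetBags s ↔ ∃ x i, gadgetBag x i = B := by
  simp [gadgetBags]

theorem mem_testBags {B : Finset (Vertex s)} :
    B ∈ testBags s ↔ ∃ i, insert (q i) (core s) = B := by
  simp [testBags]

/-- All bags, from the root downwards. -/
noncomputable def bags (s : ℕ) : List (Finset (Vertex s)) :=
  insert leaf (core s) :: (testBags s ++ gadgetBags s)

theorem mem_bags {B : Finset (Vertex s)} : B ∈ bags s ↔ B = insert leaf (core s) ∨
    (∃ i, insert (q i) (core s) = B) ∨ ∃ x i, gadgetBag x i = B := by
  rw [bags, List.mem_cons, List.mem_append, mem_testBags, mem_gadgetBags]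

theorem length_gadgetBags : (gadgetBags s).length = 3 ^ s * s := by
  simp [gadgetBags]

/-- Core vertices lie in all bags; `leaf`, `q i` and `w x i` in one each; the other vertices of the
gadget of `x` exactly in the block of bags of `x`. -/
theorem contiguous_bags (v : Vertex s) :
    Contiguous (fun B => v ∈ B) (bags s) := by
  have hcore : ∀ v ∈ core s,
      Contiguous (fun B => v ∈ B) (bags s) := by
    refine fun v hv => .of_forall fun B hB => ?_
    rcases mem_bags.1 hB with rfl | ⟨i, rfl⟩ | ⟨x, i, rfl⟩ <;> simp [hv, gadgetBag]
  have hgadget : ∀ v : Vertex s, v.IsGadget → Contiguous (fun B => v ∈ B) (gadgetBags s) →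
      Contiguous (fun B => v ∈ B) (bags s) := by
    intro v hv h
    rw [bags, ← List.cons_append]
    refine h.append_left fun B hB => ?_
    simp only [List.mem_cons, mem_testBags] at hB
    rcases hB with rfl | ⟨i, rfl⟩ <;> cases v <;> simp_all [core, IsGadget]
  have hvec : ∀ (f : (Fin s → Fin 3) → Vertex s) (x), (f x).IsGadget →
      (∀ i, f x ∈ gadgetBag x i) → (∀ x' i, x' ≠ x → f x ∉ gadgetBag x' i) →
      Contiguous (fun B => f x ∈ B) (bags s) := by
    intro f x h1 h2 h3
    refine hgadget _ h1 (.flatMap (Finset.nodup_toList _) (b := x) (by simp)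
      (.of_forall fun B hB => ?_) fun x' hx B hB => ?_)
    · obtain ⟨i, -, rfl⟩ := List.mem_map.1 hB
      exact h2 i
    · obtain ⟨i, -, rfl⟩ := List.mem_map.1 hB
      exact h3 x' i hx
  cases v with
  | b i => exact hcore _ (by simp [core])
  | beta₁ => exact hcore _ (by simp [core])
  | beta₂ => exact hcore _ (by simp [core])
  | hub => exact hcore _ (by simp [core])
  | leaf =>
    refine Contiguous.append_right (l := [insert leaf (core s)])
      (l' := testBags s ++ gadgetBags s) (.of_forall (by simp)) fun B hB => ?_
    rw [List.mem_append, mem_testBags, mem_gadgetBags] at hB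
    rcases hB with ⟨i, rfl⟩ | ⟨x, i, rfl⟩ <;> simp [gadgetBag, core]
  | q i =>
    refine .append_left (l' := [insert leaf (core s)]) (.append_right (.map
      (List.nodup_finRange s) (List.mem_finRange i) (by simp) fun j hj => ?_) fun B hB => ?_)
      fun B hB => ?_
    · simp [core, hj.symm]
    · obtain ⟨x, i, rfl⟩ := mem_gadgetBags.1 hB
      simp [gadgetBag, core]
    · rw [List.mem_singleton.1 hB]
      simp [core]
  | n x =>
    exact hvec n x trivial (by simp [gadgetBag]) fun x' i h => by simp [gadgetBag, core, h.symm]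
  | g₁ x =>
    exact hvec g₁ x trivial (by simp [gadgetBag]) fun x' i h => by simp [gadgetBag, core, h.symm]
  | g₂ x =>
    exact hvec g₂ x trivial (by simp [gadgetBag]) fun x' i h => by simp [gadgetBag, core, h.symm]
  | a₁ x =>
    exact hvec a₁ x trivial (by simp [gadgetBag]) fun x' i h => by simp [gadgetBag, core, h.symm]
  | a₂ x =>
    exact hvec a₂ x trivial (by simp [gadgetBag]) fun x' i h => by simp [gadgetBag, core, h.symm]
  | w x i =>
    refine hgadget _ trivial (.flatMap (Finset.nodup_toList _) (b := x) (by simp)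
      (.map (List.nodup_finRange s) (List.mem_finRange i) (by simp [gadgetBag]) fun j hj => ?_)
      fun x' hx B hB => ?_)
    · simp [gadgetBag, core, hj.symm]
    · obtain ⟨j, -, rfl⟩ := List.mem_map.1 hB
      simp [gadgetBag, core, hx.symm]

/-- The bags of the path decomposition as sets of vertex names. -/
noncomputable def nameBag (B : Finset (Vertex s)) : Finset (Fin (Fintype.card (Vertex s))) :=
  B.map (name s).toEmbedding

theorem mem_nameBag {B : Finset (Vertex s)} {v} : v ∈ nameBag B ↔ (name s).symm v ∈ B := by
  simp [nameBag, Finset.mem_map_equiv]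

/-- The path decomposition of the graphs of the lower bound. -/
noncomputable def pathDecomposition (s : ℕ) :
    RTree (Finset (Fin (Fintype.card (Vertex s)))) :=
  .chain (nameBag (insert leaf (core s))) ((testBags s ++ gadgetBags s).map nameBag)

theorem mem_labels_pathDecomposition {B : Finset (Fin (Fintype.card (Vertex s)))} :
    B ∈ (pathDecomposition s).labels ↔ ∃ B' ∈ bags s, nameBag B' = B := by
  rw [pathDecomposition, RTree.labels_chain, List.mem_reverse, ← List.map_cons, List.mem_map]
  rfl

theorem mem_core_of_edgeRel {F : Finset (Fin s → Fin 3)} {y} {u v : Vertex s}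
    (h : EdgeRel F y u v) (hu : ¬ u.IsGadget) : v ∈ core s := by
  cases u <;> cases v <;> simp_all [EdgeRel, IsGadget, core]

/-- The index matters only if some `w x i` is an end of the edge; otherwise any index serves, and
`hs` provides one. -/
theorem exists_gadgetBag_of_edgeRel (hs : 0 < s) {F : Finset (Fin s → Fin 3)} {y}
    {u v : Vertex s} (h : EdgeRel F y u v) (hu : u.IsGadget) :
    ∃ x i, u ∈ gadgetBag x i ∧ v ∈ gadgetBag x i := by
  cases u with
  | n x =>
    cases v with
    | w x' i => exact ⟨x, i, by simp_all [EdgeRel, gadgetBag]⟩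
    | _ => exact ⟨x, ⟨0, hs⟩, by simp_all [EdgeRel, gadgetBag, core]⟩
  | a₁ x => exact ⟨x, ⟨0, hs⟩, by cases v <;> simp_all [EdgeRel, gadgetBag, core]⟩
  | a₂ x => exact ⟨x, ⟨0, hs⟩, by cases v <;> simp_all [EdgeRel, gadgetBag, core]⟩
  | w x i => exact ⟨x, i, by cases v <;> simp_all [EdgeRel, gadgetBag, core]⟩
  | _ => simp_all [EdgeRel, IsGadget]

theorem exists_bag (hs : 0 < s) (v : Vertex s) : ∃ B ∈ bags s, v ∈ B := by
  simp only [mem_bags]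
  cases v with
  | q i => exact ⟨_, .inr (.inl ⟨i, rfl⟩), by simp⟩
  | w x i => exact ⟨_, .inr (.inr ⟨x, i, rfl⟩), by simp [gadgetBag]⟩
  | n x => exact ⟨_, .inr (.inr ⟨x, ⟨0, hs⟩, rfl⟩), by simp [gadgetBag]⟩
  | g₁ x => exact ⟨_, .inr (.inr ⟨x, ⟨0, hs⟩, rfl⟩), by simp [gadgetBag]⟩
  | g₂ x => exact ⟨_, .inr (.inr ⟨x, ⟨0, hs⟩, rfl⟩), by simp [gadgetBag]⟩
  | a₁ x => exact ⟨_, .inr (.inr ⟨x, ⟨0, hs⟩, rfl⟩), by simp [gadgetBag]⟩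
  | a₂ x => exact ⟨_, .inr (.inr ⟨x, ⟨0, hs⟩, rfl⟩), by simp [gadgetBag]⟩
  | _ => exact ⟨_, .inl rfl, by simp [core]⟩

theorem exists_bag_of_edgeRel (hs : 0 < s) {F : Finset (Fin s → Fin 3)} {y} {u v : Vertex s}
    (h : EdgeRel F y u v) : ∃ B ∈ bags s, u ∈ B ∧ v ∈ B := by
  by_cases hu : u.IsGadget
  · obtain ⟨x, i, h⟩ := exists_gadgetBag_of_edgeRel hs h hu
    exact ⟨_, mem_bags.2 (.inr (.inr ⟨x, i, rfl⟩)), h⟩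
  · have hv := mem_core_of_edgeRel h hu
    obtain ⟨B, hB, hu'⟩ := exists_bag hs u
    refine ⟨B, hB, hu', ?_⟩
    rcases mem_bags.1 hB with rfl | ⟨i, rfl⟩ | ⟨x, i, rfl⟩
    · exact Finset.mem_insert_of_mem hv
    · exact Finset.mem_insert_of_mem hv
    · exact Finset.mem_union_left _ hv

theorem isTreeDecomposition_pathDecomposition (hs : 0 < s) (F : Finset (Fin s → Fin 3)) (y) :
    IsTreeDecomposition (namedGraph F y) (pathDecomposition s) := by
  refine ⟨fun v => ?_, fun u v huv => ?_, fun v => ?_⟩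
  · obtain ⟨B, hB, h⟩ := exists_bag hs ((name s).symm v)
    exact ⟨nameBag B, mem_labels_pathDecomposition.2 ⟨B, hB, rfl⟩, mem_nameBag.2 h⟩
  · have : ∃ B ∈ bags s, (name s).symm u ∈ B ∧ (name s).symm v ∈ B := by
      rcases huv.2 with h | h
      · exact exists_bag_of_edgeRel hs h
      · obtain ⟨B, hB, h1, h2⟩ := exists_bag_of_edgeRel hs h
        exact ⟨B, hB, h2, h1⟩
    obtain ⟨B, hB, h1, h2⟩ := this
    exact ⟨nameBag B, mem_labels_pathDecomposition.2 ⟨B, hB, rfl⟩, mem_nameBag.2 h1,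
      mem_nameBag.2 h2⟩
  · refine Contiguous.preconnected_chain (p := fun B => v ∈ B) ?_
    rw [← List.map_cons]
    refine .of_map ?_
    simp only [mem_nameBag]
    exact contiguous_bags ((name s).symm v)

/-- Gadget bags are largest: `s + 3` core vertices and six of the gadget. -/
theorem bagWidth_pathDecomposition (hs : 0 < s) : bagWidth (pathDecomposition s) = s + 8 := by
  rw [bagWidth, RTree.foldr_max_eq (m := s + 9)]
  · rfl
  · intro m hm
    obtain ⟨_, hB', rfl⟩ := List.mem_map.1 hm
    obtain ⟨B, hB, rfl⟩ := mem_labels_pathDecomposition.1 hB'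
    rcases mem_bags.1 hB with rfl | ⟨i, rfl⟩ | ⟨x, i, rfl⟩
    · have := Finset.card_insert_le leaf (core s)
      rw [card_core] at this
      rw [nameBag, Finset.card_map]
      omega
    · have := Finset.card_insert_le (q i) (core s)
      rw [card_core] at this
      rw [nameBag, Finset.card_map]
      omega
    · rw [nameBag, Finset.card_map, card_gadgetBag]
  · refine List.mem_map.2 ⟨nameBag (gadgetBag 0 ⟨0, hs⟩),
      mem_labels_pathDecomposition.2
        ⟨_, mem_bags.2 (.inr (.inr ⟨0, ⟨0, hs⟩, rfl⟩)), rfl⟩, ?_⟩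
    rw [nameBag, Finset.card_map, card_gadgetBag]

/-- A generous bound for the size of both decompositions, with `c = 0` for paths and `c = 5` for
treedepth. -/
theorem gadget_size_le (s c : ℕ) (hc : c ≤ 8) : 3 ^ s * (s + c) + 2 * s + 8 ≤ 2 ^ (10 * (s + 1)) := by
  have h1 : s < 2 ^ s := Nat.lt_two_pow_self
  have h2 : 3 ^ s ≤ 2 ^ (2 * s) := by
    rw [pow_mul]
    exact Nat.pow_le_pow_left (by norm_num) s
  have h3 : 0 < 2 ^ s := by positivity
  have h4 : 2 ^ (10 * (s + 1)) = 2 ^ (2 * s) * 2 ^ s * (2 ^ (7 * s) * 1024) := by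
    rw [← pow_add, show 1024 = 2 ^ 10 by norm_num, ← pow_add, ← pow_add]
    congr 1
    ring
  have h5 : 0 < 2 ^ (7 * s) := by positivity
  have h6 : 0 < 2 ^ (2 * s) := by positivity
  rw [h4]
  calc 3 ^ s * (s + c) + 2 * s + 8 ≤ 2 ^ (2 * s) * (9 * 2 ^ s) + 2 ^ (2 * s) * (10 * 2 ^ s) := by
        have h7 : 3 ^ s * (s + c) ≤ 2 ^ (2 * s) * (9 * 2 ^ s) :=
          Nat.mul_le_mul h2 (by omega)
        have h8 : 1 * (10 * 2 ^ s) ≤ 2 ^ (2 * s) * (10 * 2 ^ s) := Nat.mul_le_mul_right _ h6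
        omega
    _ = 2 ^ (2 * s) * 2 ^ s * 19 := by ring
    _ ≤ _ := Nat.mul_le_mul_left _ (by omega)

/-- The instance of Dominating Set with the path decomposition. -/
noncomputable def pathInstance (F : Finset (Fin s → Fin 3)) (y : Fin s → Fin 3) : DPInstance where
  order := Fintype.card (Vertex s)
  graph := namedGraph F y
  seps := (pathDecomposition s).map fun B => B.sort
  width := s + 8
  budget := budget y

theorem namedGraph_adj_congr_right (F : Finset (Fin s → Fin 3)) (y y' : Fin s → Fin 3) :
    ∀ u ∈ {u | (name s).symm u ∈ core s ∨ ((name s).symm u).IsGadget},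
    ∀ v ∈ {u | (name s).symm u ∈ core s ∨ ((name s).symm u).IsGadget},
    ¬ (u ∈ {u | (name s).symm u ∈ core s} ∧ v ∈ {u | (name s).symm u ∈ core s}) →
      ((namedGraph F y).Adj u v ↔ (namedGraph F y').Adj u v) := by
  intro u hu v hv huv
  refine graph_adj_congr_right ?_ y y'
  simp only [Set.mem_ofPred_eq] at hu hv huv
  tauto

theorem nonempty_hardFamily_path (hs : 0 < s) : Nonempty (HardFamily pathInstances 8 s) := by
  have hne : gadgetBags s ≠ [] := by
    intro h
    have := length_gadgetBags (s := s)
    rw [h, List.length_nil] at this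
    have : 0 < 3 ^ s * s := by positivity
    omega
  obtain ⟨C, l, hCl⟩ := List.exists_cons_of_ne_nil hne
  let srt : Finset (Vertex s) → List (Fin (Fintype.card (Vertex s))) := fun B => (nameBag B).sort
  have mem_srt : ∀ B u, u ∈ srt B ↔ (name s).symm u ∈ B := fun B u => by
    simp [srt, mem_nameBag]
  have seps : ((pathDecomposition s).map fun B => B.sort) = .chain (srt (insert leaf (core s)))
      ((testBags s).map srt ++ srt C :: l.map srt) := by
    simp [pathDecomposition, RTree.map_chain, hCl, srt, Function.comp_def]
  have size : ∀ (F : Finset (Fin s → Fin 3)) y, (pathInstance F y).size = 3 ^ s * s + s + 1 := by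
    intro F y
    have := length_gadgetBags (s := s)
    rw [hCl] at this
    simp only [List.length_cons] at this
    change RTree.size ((pathDecomposition s).map fun B => B.sort) = _
    rw [← RTree.length_labels, seps, RTree.labels_chain]
    simp [testBags]
    omega
  refine ⟨{
    inst := pathInstance
    -- The path is cut above the first gadget bag `C`. The vector `0` here and the set `∅` in `suf`
    -- are placeholders; `e1` and `e2` show that they do not matter.
    pre := fun F => encodeNat (s + 8) ++ encodeTree (namedGraph F 0)
      ((srt (insert leaf (core s)) :: (testBags s).map srt).getLast (by simp))
      (.chain (srt C) (l.map srt))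
    suf := fun y => chainCode (namedGraph ∅ y) [] (srt (insert leaf (core s)) :: (testBags s).map srt)
      ++ [Sym.endmark] ++ encodeNat (budget y)
    inst_mem := fun F y => ⟨namedGraph_connected, pathDecomposition s, RTree.isPath_chain _ _,
      isTreeDecomposition_pathDecomposition hs F y, (bagWidth_pathDecomposition hs).symm, rfl⟩
    encode_eq := fun F y => ?_
    width_eq := fun F y => rfl
    le_size := fun F y => by rw [size]; omega
    size_le := fun F y => by
      rw [size]
      have := gadget_size_le s 0 (by omega)
      rw [add_zero] at this
      omega
    hasDominatingSet_iff := fun F y => exists_isDominatingSet_iff }⟩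
  have e1 : encodeTree (namedGraph F y)
      ((srt (insert leaf (core s)) :: (testBags s).map srt).getLast (by simp))
      (.chain (srt C) (l.map srt)) = encodeTree (namedGraph F 0)
      ((srt (insert leaf (core s)) :: (testBags s).map srt).getLast (by simp))
      (.chain (srt C) (l.map srt)) := by
    refine encodeTree_congr (K := {u | (name s).symm u ∈ core s})
      (U := {u | (name s).symm u ∈ core s ∨ ((name s).symm u).IsGadget})
      (namedGraph_adj_congr_right F y 0) _ _
      (fun u hu => ?_) fun B hB => ?_
    · have : ∀ B ∈ srt (insert leaf (core s)) :: (testBags s).map srt, u ∈ B := by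
        intro B hB
        rw [List.mem_cons, List.mem_map] at hB
        rcases hB with rfl | ⟨B, hB, rfl⟩
        · exact (mem_srt _ _).2 (Finset.mem_insert_of_mem hu)
        · obtain ⟨i, rfl⟩ := mem_testBags.1 hB
          exact (mem_srt _ _).2 (Finset.mem_insert_of_mem hu)
      exact this _ (List.getLast_mem _)
    · rw [RTree.labels_chain, List.mem_reverse, ← List.map_cons, ← hCl, List.mem_map] at hB
      obtain ⟨B, hB, rfl⟩ := hB
      obtain ⟨x, i, rfl⟩ := mem_gadgetBags.1 hB
      simp only [mem_srt]
      refine ⟨fun u hu => Finset.mem_union_left _ hu, fun u hu => ?_⟩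
      rcases Finset.mem_union.1 hu with hu | hu
      · exact .inl hu
      · right
        simp only [Finset.mem_insert, Finset.mem_singleton] at hu
        rcases hu with h | h | h | h | h | h <;> rw [h] <;> trivial
  have e2 : chainCode (namedGraph F y) [] (srt (insert leaf (core s)) :: (testBags s).map srt) =
      chainCode (namedGraph ∅ y) [] (srt (insert leaf (core s)) :: (testBags s).map srt) := by
    refine chainCode_congr _ _ fun B hB u hu v hv => ?_
    have : ∀ u ∈ B, ¬ ((name s).symm u).IsGadget := by
      intro u hu hg
      rw [List.mem_cons, List.mem_map] at hB
      rcases hB with rfl | ⟨B, hB, rfl⟩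
      · rw [mem_srt] at hu
        cases hv : (name s).symm u <;> simp_all [core, IsGadget]
      · obtain ⟨i, rfl⟩ := mem_testBags.1 hB
        rw [mem_srt] at hu
        cases hv : (name s).symm u <;> simp_all [core, IsGadget]
    exact graph_adj_congr_left (this u hu) (this v hv) F ∅
  change encodeNat (s + 8) ++ encodeTree (namedGraph F y) []
    ((pathDecomposition s).map fun B => B.sort) ++ _ ++ encodeNat (budget y) = _
  rw [seps, encodeTree_chain_append, e1, e2]
  simp only [List.append_assoc]

end Vertex

/-! ### Trees with a stem and the code of their root paths. -/

namespace RTree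

variable {α β : Type}

theorem labels_map (f : α → β) : ∀ t : RTree α, (t.map f).labels = t.labels.map f
  | node a cs => by
    rw [map_node, labels_node, labels_node, List.map_append, List.flatMap_map, List.map_flatMap]
    congr 1
    exact List.flatMap_congr fun t _ => labels_map f t

theorem size_map (f : α → β) (t : RTree α) : (t.map f).size = t.size := by
  rw [← length_labels, labels_map, List.length_map, length_labels]

theorem height_map (f : α → β) : ∀ t : RTree α, (t.map f).height = t.height
  | node a cs => by
    rw [map_node, height_node, height_node, List.map_map]
    congr 2
    exact List.map_congr_left fun t _ => height_map f t

theorem isAncestor_node {a u v : α} {cs : List (RTree α)} :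
    (node a cs).IsAncestor u v ↔
      (a = u ∧ v ∈ (node a cs).labels) ∨ ∃ t ∈ cs, t.IsAncestor u v := by
  constructor
  · rintro ⟨t, ht, hu, hv⟩
    rw [postorder_node, List.mem_append, List.mem_flatMap, List.mem_singleton] at ht
    rcases ht with ⟨t', ht', h⟩ | rfl
    · exact .inr ⟨t', ht', t, h, hu, hv⟩
    · exact .inl ⟨hu, hv⟩
  · rintro (⟨rfl, hv⟩ | ⟨t, ht, t', ht', hu, hv⟩)
    · exact ⟨_, self_mem_postorder _, rfl, hv⟩
    · refine ⟨t', ?_, hu, hv⟩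
      rw [postorder_node]
      exact List.mem_append_left _ (List.mem_flatMap.2 ⟨t, ht, ht'⟩)

theorem IsAncestor.map (f : α → β) : ∀ {t : RTree α} {u v : α}, t.IsAncestor u v →
    (t.map f).IsAncestor (f u) (f v)
  | node a cs, u, v, h => by
    rw [map_node, isAncestor_node, ← map_node, labels_map]
    rcases isAncestor_node.1 h with ⟨rfl, hv⟩ | ⟨t, ht, h⟩
    · exact .inl ⟨rfl, List.mem_map_of_mem hv⟩
    · exact .inr ⟨_, List.mem_map_of_mem ht, IsAncestor.map f h⟩

/-- The path with labels `l` followed by `a`, from the root downwards, with subtrees `ts` attached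
at its end. -/
def stem : List α → α → List (RTree α) → RTree α
  | [], a, ts => node a ts
  | c :: l, a, ts => node c [stem l a ts]

theorem labels_stem (a : α) (ts : List (RTree α)) : ∀ l : List α,
    (stem l a ts).labels = ts.flatMap labels ++ (l ++ [a]).reverse
  | [] => by rw [stem, labels_node]; rfl
  | c :: l => by rw [stem, labels_node]; simp [labels_stem a ts l]

theorem height_stem (a : α) (ts : List (RTree α)) : ∀ l : List α,
    (stem l a ts).height = l.length + 1 + (ts.map height).foldr max 0
  | [] => by rw [stem, height_node]; simp
  | c :: l => by
    rw [stem, height_node]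
    simp [height_stem a ts l]
    omega

theorem map_stem (f : α → β) (a : α) (ts : List (RTree α)) : ∀ l : List α,
    (stem l a ts).map f = stem (l.map f) (f a) (ts.map (map f))
  | [] => by rw [stem, map_node]; rfl
  | c :: l => by rw [stem, map_node]; simp [map_stem f a ts l, stem]

theorem IsAncestor.stem {a u v : α} {ts : List (RTree α)} (h : (node a ts).IsAncestor u v) :
    ∀ l : List α, (stem l a ts).IsAncestor u v
  | [] => h
  | _ :: l => isAncestor_node.2 (.inr ⟨_, List.mem_singleton_self _, IsAncestor.stem h l⟩)

theorem isAncestor_stem_of_mem {a c v : α} {ts : List (RTree α)} (hv : v ∈ (node a ts).labels) :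
    ∀ l : List α, c ∈ l → (stem l a ts).IsAncestor c v
  | d :: l, hc => by
    rw [stem, isAncestor_node]
    rcases List.mem_cons.1 hc with rfl | hc
    · refine .inl ⟨rfl, ?_⟩
      rw [labels_node, List.flatMap_singleton, labels_stem]
      rw [labels_node] at hv
      simp only [List.mem_append, List.mem_singleton] at hv
      rcases hv with hv | rfl
      · exact List.mem_append_left _ (List.mem_append_left _ hv)
      · simp
    · exact .inr ⟨_, List.mem_singleton_self _, isAncestor_stem_of_mem hv l hc⟩

end RTree

/-- The codes of the nodes of the path at the top of a tree of root paths. -/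
noncomputable def stemCode {n : ℕ} (G : SimpleGraph (Fin n)) :
    List (Fin n) → List (Fin n) → Fin n → ℕ → List Sym
  | P, [], a, d => encodeNode G P (P ++ [a]) d
  | P, c :: l, a, d => stemCode G (P ++ [c]) l a d ++ encodeNode G P (P ++ [c]) 1

theorem stemCode_congr {n : ℕ} {G G' : SimpleGraph (Fin n)} {U : Set (Fin n)}
    (hG : ∀ u ∈ U, ∀ v ∈ U, (G.Adj u v ↔ G'.Adj u v)) {a : Fin n} (ha : a ∈ U) (d : ℕ) :
    ∀ (P l : List (Fin n)), (∀ u ∈ P, u ∈ U) → (∀ u ∈ l, u ∈ U) →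
      stemCode G P l a d = stemCode G' P l a d
  | P, [], hP, _ => by
    have h : ∀ u ∈ P ++ [a], u ∈ U := by simpa [or_imp, forall_and] using ⟨hP, ha⟩
    exact encodeNode_congr _ fun u hu v hv _ => hG u (h u hu) v (h v hv)
  | P, c :: l, hP, hl => by
    have h : ∀ u ∈ P ++ [c], u ∈ U := by
      simpa [or_imp, forall_and] using ⟨hP, hl c List.mem_cons_self⟩
    rw [stemCode, stemCode, stemCode_congr hG ha d _ l h fun u hu => hl u (by simp [hu]),
      encodeNode_congr _ fun u hu v hv _ => hG u (h u hu) v (h v hv)]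

/-- In post-order the attached subtrees precede the stem, so the edges between stem vertices are
written last. -/
theorem encodeTree_rootPathsAux_stem {n : ℕ} (G : SimpleGraph (Fin n)) (a : Fin n)
    (ts : List (RTree (Fin n))) : ∀ (P l : List (Fin n)),
    encodeTree G P ((RTree.stem l a ts).rootPathsAux P) =
      (ts.flatMap fun t =>
        encodeTree G (P ++ (l ++ [a])) (t.rootPathsAux (P ++ (l ++ [a])))) ++
        stemCode G P l a ts.length
  | P, [] => by
    rw [RTree.stem, RTree.rootPathsAux_node, encodeTree_node, List.flatMap_map, List.length_map]
    rfl
  | P, c :: l => by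
    rw [RTree.stem, RTree.rootPathsAux_node, encodeTree_node, stemCode]
    simp [encodeTree_rootPathsAux_stem G a ts (P ++ [c]) l]

/-! ### The treedepth decomposition -/

namespace Vertex

open RTree

variable {s : ℕ}

/-- The treedepth decomposition of the gadget of `x`. -/
def gadgetTree (x : Fin s → Fin 3) : RTree (Vertex s) :=
  .node (n x) [.node (g₁ x) [.node (g₂ x) [.node (a₁ x) [.node (a₂ x)
    ((List.finRange s).map fun i => .node (w x i) [])]]]]

/-- The core vertices above `hub`, in the order in which they occur in the decomposition. -/
def coreList (s : ℕ) : List (Vertex s) := (List.finRange s).map b ++ [beta₁, beta₂]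

/-- The leaves below `hub`. -/
def testTrees (s : ℕ) : List (RTree (Vertex s)) :=
  .node leaf [] :: (List.finRange s).map fun i => .node (q i) []

/-- The trees below `hub`. -/
noncomputable def subtrees (s : ℕ) : List (RTree (Vertex s)) :=
  -- The order matters: gadgets must precede the leaves that depend on `y`.
  Finset.univ.toList.map gadgetTree ++ testTrees s

/-- The treedepth decomposition of the graphs of the lower bound. -/
noncomputable def treedepthTree (s : ℕ) : RTree (Vertex s) := stem (coreList s) hub (subtrees s)

theorem labels_gadgetTree (x : Fin s → Fin 3) :
    (gadgetTree x).labels = (List.finRange s).map (w x) ++ [a₂ x, a₁ x, g₂ x, g₁ x, n x] := by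
  simp [gadgetTree, labels_node, List.flatMap_map, ← List.map_eq_flatMap]

theorem labels_testTrees : (testTrees s).flatMap labels = leaf :: (List.finRange s).map q := by
  simp [testTrees, labels_node, List.flatMap_map, ← List.map_eq_flatMap]

theorem labels_subtrees : (subtrees s).flatMap labels =
    (Finset.univ.toList.flatMap fun x => (gadgetTree x).labels) ++
      leaf :: (List.finRange s).map q := by
  rw [subtrees, List.flatMap_append, labels_testTrees, List.flatMap_map]

theorem labels_treedepthTree : (treedepthTree s).labels =
    ((Finset.univ.toList.flatMap fun x => (gadgetTree x).labels) ++
      leaf :: (List.finRange s).map q) ++ (coreList s ++ [hub]).reverse := by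
  rw [treedepthTree, labels_stem, labels_subtrees]

theorem mem_labels_treedepthTree (v : Vertex s) : v ∈ (treedepthTree s).labels := by
  rw [labels_treedepthTree]
  cases v <;> simp [labels_gadgetTree, coreList]

theorem nodup_labels_treedepthTree : (treedepthTree s).labels.Nodup := by
  have inj : ∀ f : Fin s → Vertex s, Function.Injective f → ((List.finRange s).map f).Nodup :=
    fun f hf => (List.nodup_finRange s).map hf
  have hw : ∀ x : Fin s → Fin 3, Function.Injective (w x) := fun x i j h => by simpa using h
  have hq : Function.Injective (q (s := s)) := fun i j h => by simpa using h
  have hb : Function.Injective (b (s := s)) := fun i j h => by simpa using h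
  rw [labels_treedepthTree, List.nodup_append', List.nodup_append', List.nodup_flatMap,
    List.nodup_reverse]
  refine ⟨⟨⟨fun x _ => ?_, ?_⟩, ?_, ?_⟩, ?_, ?_⟩
  · rw [labels_gadgetTree, List.nodup_append']
    exact ⟨inj _ (hw x), by simp, by simp [List.Disjoint]⟩
  · refine (Finset.nodup_toList _).imp fun {x x'} h => ?_
    simp only [Function.onFun, List.Disjoint, labels_gadgetTree]
    intro v hv hv'
    cases v <;> simp_all
  · simpa using inj _ hq
  · intro v hv hv'
    cases v <;> simp_all [labels_gadgetTree]
  · rw [coreList, List.append_assoc, List.nodup_append']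
    exact ⟨inj _ hb, by simp, by simp [List.Disjoint]⟩
  · intro v hv hv'
    cases v <;> simp_all [labels_gadgetTree, coreList]

/-- The stem has `s + 3` nodes and a gadget six levels, the last one present because `s` is
positive. -/
theorem height_treedepthTree (hs : 0 < s) : (treedepthTree s).height = s + 9 := by
  have hg : ∀ x : Fin s → Fin 3, (gadgetTree x).height = 6 := by
    intro x
    have : (List.replicate s 1).foldr max 0 = 1 :=
      foldr_max_eq (by simp) (by simp [hs.ne'])
    simp [gadgetTree, height_node, Function.comp_def, this]
  have : ((subtrees s).map height).foldr max 0 = 6 := by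
    refine foldr_max_eq (fun m hm => ?_) ?_
    · simp only [subtrees, testTrees, List.map_append, List.map_cons, List.map_map,
        List.mem_append, List.mem_cons, List.mem_map, Function.comp_apply, hg, height_node] at hm
      rcases hm with ⟨_, _, rfl⟩ | rfl | ⟨_, _, rfl⟩ <;> simp
    · simp [subtrees, hg, Function.comp_def]
  rw [treedepthTree, height_stem, this]
  simp [coreList]

theorem size_treedepthTree : (treedepthTree s).size = 3 ^ s * (s + 5) + 2 * s + 4 := by
  rw [← length_labels, labels_treedepthTree]
  simp [labels_gadgetTree, coreList]
  ring

theorem isAncestor_core {c v : Vertex s} (hc : c ∈ core s) (hv : v ∉ core s) :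
    (treedepthTree s).IsAncestor c v := by
  have h1 : v ∈ (RTree.node hub (subtrees s)).labels := by
    have := mem_labels_treedepthTree v
    rw [treedepthTree, labels_stem] at this
    rw [labels_node]
    rcases List.mem_append.1 this with h | h
    · exact List.mem_append_left _ h
    · refine absurd ?_ hv
      simp only [coreList, List.mem_reverse] at h
      cases v <;> simp_all [core]
  by_cases h : c = hub
  · exact IsAncestor.stem (isAncestor_node.2 (.inl ⟨h.symm, h1⟩)) _
  · refine isAncestor_stem_of_mem h1 _ ?_
    cases c <;> simp_all [core, coreList]

theorem isAncestor_b_hub (i : Fin s) : (treedepthTree s).IsAncestor (b i) hub :=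
  isAncestor_stem_of_mem (by simp [labels_node]) _ (by simp [coreList])

theorem isAncestor_of_gadgetTree {x : Fin s → Fin 3} {u v : Vertex s}
    (h : (gadgetTree x).IsAncestor u v) : (treedepthTree s).IsAncestor u v :=
  IsAncestor.stem (isAncestor_node.2 (.inr ⟨_, by simp [subtrees], h⟩)) _

theorem IsGadget.notMem_core {v : Vertex s} (h : v.IsGadget) : v ∉ core s := by
  cases v <;> simp_all [core, IsGadget]

/-- The stem lies above everything else, so only edges inside the core, which join some `b i` to
`hub`, and edges inside one gadget need a check. -/
theorem isAncestor_of_edgeRel {F : Finset (Fin s → Fin 3)} {y} {u v : Vertex s}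
    (h : EdgeRel F y u v) :
    (treedepthTree s).IsAncestor u v ∨ (treedepthTree s).IsAncestor v u := by
  by_cases hv : v ∈ core s
  · by_cases hu : u ∈ core s
    · cases u with
      | b i => cases v <;> simp_all [EdgeRel, isAncestor_b_hub]
      | _ => cases v <;> simp_all [EdgeRel, core]
    · exact .inr (isAncestor_core hv hu)
  · have hu : u.IsGadget := by
      by_contra hu
      exact hv (mem_core_of_edgeRel h hu)
    cases u with
    | n x =>
      refine .inl (isAncestor_of_gadgetTree (x := x) ?_)
      cases v <;> simp_all [EdgeRel, core, gadgetTree, isAncestor_node, labels_node]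
    | a₁ x =>
      refine .inr (isAncestor_of_gadgetTree (x := x) ?_)
      cases v <;> simp_all [EdgeRel, core, gadgetTree, isAncestor_node, labels_node]
    | a₂ x =>
      refine .inr (isAncestor_of_gadgetTree (x := x) ?_)
      cases v <;> simp_all [EdgeRel, core, gadgetTree, isAncestor_node, labels_node]
    | w x i => cases v <;> simp_all [EdgeRel, core]
    | _ => simp_all [EdgeRel, IsGadget]

/-- The treedepth decomposition on the vertex names. -/
noncomputable def treedepthDecomposition (s : ℕ) : RTree (Fin (Fintype.card (Vertex s))) :=
  (treedepthTree s).map (name s)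

theorem isTreedepthDecomposition (F : Finset (Fin s → Fin 3)) (y) :
    IsTreedepthDecomposition (namedGraph F y) (treedepthDecomposition s) := by
  refine ⟨fun v => ?_, ?_, fun u v huv => ?_⟩
  · rw [treedepthDecomposition, labels_map]
    exact List.mem_map.2 ⟨_, mem_labels_treedepthTree _, (name s).apply_symm_apply v⟩
  · rw [treedepthDecomposition, labels_map]
    exact nodup_labels_treedepthTree.map (name s).injective
  · have : (treedepthTree s).IsAncestor ((name s).symm u) ((name s).symm v) ∨
        (treedepthTree s).IsAncestor ((name s).symm v) ((name s).symm u) := by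
      rcases huv.2 with h | h
      · exact isAncestor_of_edgeRel h
      · exact (isAncestor_of_edgeRel h).symm
    rcases this with h | h
    · exact .inl (by simpa [treedepthDecomposition] using h.map (name s))
    · exact .inr (by simpa [treedepthDecomposition] using h.map (name s))

/-- The instance of Dominating Set with the treedepth decomposition. -/
noncomputable def treedepthInstance (F : Finset (Fin s → Fin 3)) (y : Fin s → Fin 3) :
    DPInstance where
  order := Fintype.card (Vertex s)
  graph := namedGraph F y
  seps := (treedepthDecomposition s).rootPaths
  width := s + 9
  budget := budget y

theorem nonempty_hardFamily_treedepth (hs : 0 < s) :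
    Nonempty (HardFamily treedepthInstances 9 s) := by
  let coreNames := (coreList s).map (name s) ++ [name s hub]
  have mem_coreNames : ∀ u, u ∈ coreNames ↔ (name s).symm u ∈ core s := by
    intro u
    obtain ⟨u, rfl⟩ := (name s).surjective u
    simp only [coreNames, List.mem_append, List.mem_map, EmbeddingLike.apply_eq_iff_eq,
      exists_eq_right, List.mem_singleton, Equiv.symm_apply_apply]
    cases u <;> simp [coreList, core]
  let code : SimpleGraph (Fin (Fintype.card (Vertex s))) → List (RTree (Vertex s)) → List Sym :=
    fun G ts => ts.flatMap fun t => encodeTree G coreNames ((t.map (name s)).rootPathsAux coreNames)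
  have encode_eq : ∀ F y, encodeTree (namedGraph F y) [] (treedepthDecomposition s).rootPaths =
      code (namedGraph F y) (Finset.univ.toList.map gadgetTree) ++
        (code (namedGraph F y) (testTrees s) ++ stemCode (namedGraph F y) []
          ((coreList s).map (name s)) (name s hub) (subtrees s).length) := by
    intro F y
    rw [RTree.rootPaths, treedepthDecomposition, treedepthTree, map_stem,
      encodeTree_rootPathsAux_stem, List.flatMap_map, List.length_map, List.nil_append]
    simp only [code, subtrees, List.flatMap_append, List.append_assoc]
    rfl
  have size : ∀ F (y : Fin s → Fin 3),
      (treedepthInstance F y).size = 3 ^ s * (s + 5) + 2 * s + 4 := by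
    intro F y
    change ((treedepthDecomposition s).rootPathsAux []).size = _
    rw [size_rootPathsAux, treedepthDecomposition, size_map, size_treedepthTree]
  have mem_labels : ∀ (t : RTree (Vertex s)),
      ∀ B ∈ ((t.map (name s)).rootPathsAux coreNames).labels,
        (∀ u, (name s).symm u ∈ core s → u ∈ B) ∧
          ∀ u ∈ B, (name s).symm u ∈ core s ∨ (name s).symm u ∈ t.labels := by
    intro t B hB
    obtain ⟨h1, h2⟩ := mem_labels_rootPathsAux _ _ B hB
    refine ⟨fun u hu => h1 ((mem_coreNames u).2 hu), fun u hu => ?_⟩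
    rcases h2 u hu with h | h
    · exact .inl ((mem_coreNames u).1 h)
    · rw [labels_map] at h
      obtain ⟨v, hv, rfl⟩ := List.mem_map.1 h
      exact .inr (by simpa using hv)
  refine ⟨{
    inst := treedepthInstance
    pre := fun F => encodeNat (s + 9) ++
      code (namedGraph F 0) (Finset.univ.toList.map gadgetTree)
    suf := fun y => code (namedGraph ∅ y) (testTrees s) ++ stemCode (namedGraph ∅ y) []
      ((coreList s).map (name s)) (name s hub) (subtrees s).length ++
        [Sym.endmark] ++ encodeNat (budget y)
    inst_mem := fun F y => ⟨namedGraph_connected, treedepthDecomposition s,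
      isTreedepthDecomposition F y, ?_, rfl⟩
    encode_eq := fun F y => ?_
    width_eq := fun F y => rfl
    le_size := fun F y => by rw [size]; omega
    size_le := fun F y => by
      rw [size]
      have := gadget_size_le s 5 (by omega)
      omega
    hasDominatingSet_iff := fun F y => exists_isDominatingSet_iff }⟩
  · change s + 9 = (treedepthDecomposition s).height
    rw [treedepthDecomposition, height_map, height_treedepthTree hs]
  have e1 : code (namedGraph F y) (Finset.univ.toList.map gadgetTree) =
      code (namedGraph F 0) (Finset.univ.toList.map gadgetTree) := by
    refine List.flatMap_congr fun t ht => ?_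
    obtain ⟨x, -, rfl⟩ := List.mem_map.1 ht
    refine encodeTree_congr (namedGraph_adj_congr_right F y 0) _ _
      (fun u hu => (mem_coreNames u).2 hu) fun B hB => ?_
    obtain ⟨h1, h2⟩ := mem_labels _ B hB
    refine ⟨h1, fun u hu => (h2 u hu).imp_right fun h => ?_⟩
    rw [labels_gadgetTree] at h
    cases hv : (name s).symm u <;> simp_all [IsGadget]
  have hU : ∀ u ∈ {u | ¬ ((name s).symm u).IsGadget}, ∀ v ∈ {u | ¬ ((name s).symm u).IsGadget},
      ((namedGraph F y).Adj u v ↔ (namedGraph ∅ y).Adj u v) := fun u hu v hv =>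
    graph_adj_congr_left hu hv F ∅
  have hcore : ∀ u, (name s).symm u ∈ core s → u ∈ {u | ¬ ((name s).symm u).IsGadget} :=
    fun u hu hg => hg.notMem_core hu
  have e2 : code (namedGraph F y) (testTrees s) = code (namedGraph ∅ y) (testTrees s) := by
    refine List.flatMap_congr fun t ht => ?_
    -- No gadget vertex occurs in these separators, so the graphs for `F` and `∅` agree on all edges
    -- there and none has to be excluded.
    refine encodeTree_congr (K := ∅) (fun u hu v hv _ => hU u hu v hv) _ _
      (fun u hu => hu.elim) fun B hB => ⟨fun u hu => hu.elim, fun u hu => ?_⟩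
    rcases (mem_labels _ B hB).2 u hu with h | h
    · exact hcore u h
    · have h' : (name s).symm u ∈ (testTrees s).flatMap labels := List.mem_flatMap.2 ⟨t, ht, h⟩
      rw [labels_testTrees] at h'
      intro hg
      cases hv : (name s).symm u <;> simp_all [IsGadget]
  have e3 : stemCode (namedGraph F y) [] ((coreList s).map (name s)) (name s hub)
      (subtrees s).length = stemCode (namedGraph ∅ y) [] ((coreList s).map (name s)) (name s hub)
      (subtrees s).length := by
    refine stemCode_congr hU (hcore _ ((mem_coreNames _).1 (by simp [coreNames]))) _ _ _ (by simp)
      fun u hu => hcore u ((mem_coreNames u).1 (List.mem_append_left _ hu))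
  change encodeNat (s + 9) ++ encodeTree (namedGraph F y) []
    (treedepthDecomposition s).rootPaths ++ _ ++ encodeNat (budget y) = _
  rw [encode_eq, e1, e2, e3]
  simp only [List.append_assoc]

end Vertex

/-! ### Conclusion for the three kinds of decomposition. -/

theorem pathInstances_subset_treeInstances : pathInstances ⊆ treeInstances :=
  fun _ ⟨hc, T, _, h⟩ => ⟨hc, T, h⟩

end DPSpace

open DPSpace in
theorem mainTheorem1 (ε : ℝ) (hε : 0 < ε) :
    (¬ ∃ M : DPTM, M.DecidesDominatingSet treeInstances ∧
        M.UsesSpaceBigO treeInstances (3 - ε)) ∧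
    (¬ ∃ M : DPTM, M.DecidesDominatingSet pathInstances ∧
        M.UsesSpaceBigO pathInstances (3 - ε)) ∧
    (¬ ∃ M : DPTM, M.DecidesDominatingSet treedepthInstances ∧
        M.UsesSpaceBigO treedepthInstances (3 - ε)) := by
  have hb : 3 - ε < 3 := by linarith
  have path := not_decides_of_hardFamily (fun _ => Vertex.nonempty_hardFamily_path) hb
  refine ⟨?_, path,
    not_decides_of_hardFamily (fun _ => Vertex.nonempty_hardFamily_treedepth) hb⟩
  -- A machine for tree decompositions also serves path decompositions, within the same space bound.
  rintro ⟨M, hM, c, N, hc⟩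
  exact path ⟨M, fun I hI => hM I (pathInstances_subset_treeInstances hI), c, N,
    fun I hI => hc I (pathInstances_subset_treeInstances hI)⟩
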